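/- Let $p$ be an odd prime, $\mathbb F_q$ a finite field of characteristic $p$ with $q$ elements, and $k\ge 1$. For coprime binary forms $g,h\in\mathbb F_q[X,Z]$ of the same degree, $h\neq 0$, let $C_{g,h}$ be the smooth projective model of $y^p-y=g(X,Z)/h(X,Z)$, that is, the normalization of $\mathbb P^1$ in the function field of this equation. Let $v=(r_1^{d_{1,1}},\dots,r_1^{d_{1,\ell_1}},\dots,r_m^{d_{m,1}},\dots,r_m^{d_{m,\ell_m}})$ with $m\ge 1$, distinct $r_i\ge 1$, $\ell_i\ge 1$, $d_{i,j}\ge 1$, and $p\nmid d_{i,j}$ for all $i,j$. Put $d=\sum_i r_i\sum_j d_{i,j}$, and let $\mathcal F_d^v$ be the set of pairs $(g,h)$ of coprime binary forms of degree $d$ over $\mathbb F_q$ such that, up to a nonzero constant, $h=\prod_{i,j}P_{i,j}^{d_{i,j}}$ with pairwise non-proportional irreducible forms $P_{i,j}$ of degree $r_i$. Suppose that $\mathcal F_d^v\ne\emptyset$. Then the average of $\#C_{g,h}(\mathbb F_{q^k})$ over $(g,h)\in\mathcal F_d^v$ is as follows. 1. If $p\nmid k$, it is exactly $q^k+1$.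 2. If $p\mid k$ and $d\ge k-1+\sum_i\ell_i r_i$, it is exactly $$q^k+1+(p-1)q^{k/p}+(p-1)\Bigl(1-\sum_{i:\ p r_i\mid k}\ell_i r_i\Bigr);$$ if moreover $p\nmid r_i$ for all $i$, this equals $$q^k+1+(p-1)q^{k/p}+(p-1)\Bigl(1-\sum_{i:\ r_i\mid k}\ell_i r_i\Bigr).$$ In the case of $p$-rank $0$, let $d\geq 1$ with $p\nmid d$. The average number of $\mathbb F_{q^k}$-points on the smooth projective model of $y^p-y=f(x)$, over all polynomials $f\in\mathbb F_q[x]$ of degree exactly $d$, is $q^k+1$ if $p\nmid k$, and $q^k+1+(p-1)q^{k/p}$ if $p\mid k$ and $k\le d$. -/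

import Mathlib

open Polynomial

noncomputable section

namespace ArtinSchreier

universe u w

/-! ### The curve of an Artin–Schreier equation -/

section Curve

variable {F : Type u} [Field F]

/-- The polynomial `Y ^ p - Y - a / b` over the rational function field `F(t)`. -/
def equation (p : ℕ) (a b : F[X]) : (RatFunc F)[X] :=
  X ^ p - X - C (algebraMap F[X] (RatFunc F) a / algebraMap F[X] (RatFunc F) b)

/-- The function field `F(t)[y]`, `y ^ p - y = a / b`, of the cover. -/
abbrev FunctionField (p : ℕ) (a b : F[X]) : Type u := AdjoinRoot (equation p a b)

/-- The coordinate ring of the part of the smooth projective model of `y ^ p - y = a(t) / b(t)`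
that lies over the affine `t`-line: the integral closure of `F[t]` in the function field. -/
abbrev CoordinateRing (p : ℕ) (a b : F[X]) : Type u :=
  integralClosure F[X] (FunctionField p a b)

/-- The points with values in the extension `E` of `F` of the part of the smooth projective model
of `y ^ p - y = a(t) / b(t)` that lies over the affine `t`-line. -/
abbrev AffinePoints (p : ℕ) (a b : F[X]) (E : Type w) [Field E] [Algebra F E] : Type (max u w) :=
  CoordinateRing p a b →ₐ[F] E

/-- The dehomogenization `g(X, 1)` of a form `g(X, Z)`; here `X` is the variable `0` and
`Z` is the variable `1`. -/
def dehomogenizeZ (g : MvPolynomial (Fin 2) F) : F[X] := MvPolynomial.aeval ![X, 1] g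

/-- The dehomogenization `g(1, Z)` of a form `g(X, Z)`. -/
def dehomogenizeX (g : MvPolynomial (Fin 2) F) : F[X] := MvPolynomial.aeval ![1, X] g

/-- The number of `E`-points of the smooth projective model of
`y ^ p - y = g(X, Z) / h(X, Z)`, that is, of the normalization of the projective line in the
function field of the cover. The first term counts the points over the chart `Z ≠ 0`, with
coordinate `t = X / Z`; the second one counts the points over `[1 : 0]`, which is the origin of the
chart `X ≠ 0` with coordinate `t = Z / X`. -/
def numPoints (p : ℕ) (g h : MvPolynomial (Fin 2) F) (E : Type w) [Field E] [Algebra F E] : ℕ :=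
  Nat.card (AffinePoints p (dehomogenizeZ g) (dehomogenizeZ h) E) +
    Nat.card {φ : AffinePoints p (dehomogenizeX g) (dehomogenizeX h) E //
      φ (algebraMap F[X] (CoordinateRing p (dehomogenizeX g) (dehomogenizeX h)) X) = 0}

end Curve

/-! ### Factorization types -/

/-- A factorization type
`v = (r₁ ^ d₁₁, …, r₁ ^ d₁ℓ₁, …, r_m ^ d_m1, …, r_m ^ d_mℓ_m)` with `m ≥ 1`, distinct positive
degrees `r i`, multiplicities `ℓ i ≥ 1` and exponents `d i j ≥ 1`. -/
structure FactorizationType where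
  m : ℕ
  r : Fin m → ℕ
  ℓ : Fin m → ℕ
  d : (i : Fin m) → Fin (ℓ i) → ℕ
  m_pos : 0 < m
  r_pos : ∀ i, 0 < r i
  r_injective : Function.Injective r
  ℓ_pos : ∀ i, 0 < ℓ i
  d_pos : ∀ i j, 0 < d i j

namespace FactorizationType

/-- The degree `∑ i, r i * ∑ j, d i j` of the forms of factorization type `v`. -/
def degree (v : FactorizationType) : ℕ := ∑ i, v.r i * ∑ j, v.d i j

/-- The number `∑ i, ℓ i * r i` of geometric poles. -/
def numPoles (v : FactorizationType) : ℕ := ∑ i, v.ℓ i * v.r i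

/-- The binary form `h` has factorization type `v`: up to a nonzero constant it is the product of
the `P i j ^ d i j` for pairwise distinct (non-proportional) irreducible forms `P i j` of
degree `r i`. -/
def HasType {F : Type u} [Field F] (v : FactorizationType) (h : MvPolynomial (Fin 2) F) : Prop :=
  ∃ P : (i : Fin v.m) → Fin (v.ℓ i) → MvPolynomial (Fin 2) F,
    (∀ i j, (P i j).IsHomogeneous (v.r i) ∧ Irreducible (P i j)) ∧
    (∀ i j i' j', Associated (P i j) (P i' j') →
      (⟨i, j⟩ : (i : Fin v.m) × Fin (v.ℓ i)) = ⟨i', j'⟩) ∧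
    Associated h (∏ i, ∏ j, P i j ^ v.d i j)

end FactorizationType

/-- The family `F_d^v`: the pairs `(g, h)` of coprime binary forms of degree `d` for which `h` has
factorization type `v`, where `d` is the degree of `v`. -/
def family (F : Type u) [Field F] (v : FactorizationType) :
    Set (MvPolynomial (Fin 2) F × MvPolynomial (Fin 2) F) :=
  {x | x.1.IsHomogeneous v.degree ∧ x.2.IsHomogeneous v.degree ∧ IsRelPrime x.1 x.2 ∧
    v.HasType x.2}

/-- The family of the polynomials of degree `d`, which gives the covers of `p`-rank `0`. -/
def rankZeroFamily (F : Type u) [Field F] (d : ℕ) : Set F[X] := {f | f.degree = d}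

/-- The number of `E`-points of the smooth projective model of `y ^ p - y = f(x)` for a
polynomial `f`. -/
def numPointsPolynomial {F : Type u} [Field F] (p : ℕ) (f : F[X])
    (E : Type w) [Field E] [Algebra F E] : ℕ :=
  numPoints p (f.homogenize f.natDegree) ((1 : F[X]).homogenize f.natDegree) E

/-- The average of `N` over the (finite) set `S`. -/
def average {α : Type u} (S : Set α) (N : α → ℕ) : ℚ := (∑ᶠ x ∈ S, (N x : ℚ)) / S.ncard

end ArtinSchreier

end

/-!
# The average number of points on Artin–Schreier curves

Let `E` be the extension of degree `k` of the field `F` with `q` elements. The fibre of the cover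
`y ^ p - y = g / h` over a point `x` of the projective line with `h(x) ≠ 0` consists of the
solutions in `E` of `y ^ p - y = g(x) / h(x)` (`nonempty_fiber_equiv`); over a zero of `h` the order
of the pole is prime to `p`, the cover is totally ramified, and there is one point
(`natCard_fiber_of_pole`). Hence the number of points is the sum over `x ∈ ℙ¹(E)` of `fiberCount`
(`IsFactorization.numPoints_eq`), and by additive Hilbert 90 (`natCard_wp_eq`) the summand at a
point with `h(x) ≠ 0` is `p` if the trace of `g(x) / h(x)` to the prime field vanishes, and `0`
otherwise.

Fix `h`, and let `g` run through the forms prime to `h`. This set is stable under translation by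
multiples of the radical of `h`. If some such translation changes the trace of `g(x) / h(x)`, all
traces are equally frequent and `x` contributes `1` on average
(`sum_natCard_wp_of_translation`). For `p ∤ k` a constant multiple of `h` is such a translation. For
`p ∣ k` the degree condition makes the multiples of the radical take all values of the residue
field `F(x)` at `x`, so that a translation exists whenever `p ∤ [E : F(x)]`
(`IsFactorization.exists_translation`). If `p ∣ [E : F(x)]`, the trace vanishes on `F(x)` and `x`
contributes `p`. The points of the last kind are those over the subfield of `E` of degree `k / p`;
there are `q ^ (k / p) + 1` of them, and an irreducible form of degree `r` vanishes at `r` of them if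
`p r ∣ k` and at none otherwise (`card_filter_isTraceFree`, `card_filter_evalAt_eq_zero`). The
result is independent of `h`.

Polynomials of degree `d` correspond to the forms of degree `d` prime to `Z`, which reduces the
case of `p`-rank `0` to the single denominator `h = Z ^ d`.

The ramified fibre is computed with a valuation ring of the function field that dominates the local
ring of a point of the fibre. The powers `1, y, …, y ^ (p - 1)` have values in distinct classes
modulo the value group of `F(t)`; so the terms of an integral element `∑ cᵢ yⁱ` other than `c₀` have
positive valuation, and the point must send this element to `c₀(x)`. The unramified fibre rests on
the discriminant of the integral generator `b y`, which is a power of `b` up to sign.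
-/


noncomputable section

namespace ArtinSchreier

/-! ### The Artin–Schreier operator over a finite field -/

section FiniteFields

variable {p : ℕ} [Fact p.Prime] {E : Type*} [Field E] [Algebra (ZMod p) E]

theorem pow_char_eq_self_iff {y : E} :
    y ^ p = y ↔ ∃ i : ZMod p, algebraMap (ZMod p) E i = y := by
  have : CharP E p := charP_of_injective_algebraMap (algebraMap (ZMod p) E).injective p
  constructor
  · intro h
    have : y ∈ (⊥ : Subfield E) := (Subfield.mem_bot_iff_pow_eq_self E p).2 h
    rw [← ZMod.fieldRange_castHom_eq_bot p] at this
    obtain ⟨i, hi⟩ := this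
    exact ⟨i, by rw [← hi]; congr 1; exact Subsingleton.elim _ _⟩
  · rintro ⟨i, rfl⟩
    rw [← map_pow, ZMod.pow_card]

variable (p E) in
/-- The Artin–Schreier operator `y ↦ y ^ p - y`, which is linear over the prime field. -/
def wp : E →ₗ[ZMod p] E where
  toFun y := y ^ p - y
  map_add' x y := by
    have : CharP E p := charP_of_injective_algebraMap (algebraMap (ZMod p) E).injective p
    rw [add_pow_char]; ring
  map_smul' c y := by
    simp only [Algebra.smul_def, mul_pow, ← map_pow, ZMod.pow_card, RingHom.id_apply]; ring

theorem wp_apply (y : E) : wp p E y = y ^ p - y := rfl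

theorem ker_wp : LinearMap.ker (wp p E) = LinearMap.range (Algebra.linearMap (ZMod p) E) := by
  ext y
  rw [LinearMap.mem_ker, wp_apply, sub_eq_zero, pow_char_eq_self_iff]
  rfl

theorem natCard_wp_fiber {y₀ c : E} (h : y₀ ^ p - y₀ = c) :
    Nat.card {y : E // y ^ p - y = c} = p := by
  have e : ZMod p ≃ {y : E // y ^ p - y = c} := by
    refine Equiv.ofBijective (fun i => ⟨y₀ + algebraMap (ZMod p) E i, ?_⟩) ⟨?_, ?_⟩
    · have : CharP E p := charP_of_injective_algebraMap (algebraMap (ZMod p) E).injective p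
      rw [add_pow_char, ← map_pow, ZMod.pow_card, ← h]; ring
    · intro i j hij
      simpa using hij
    · rintro ⟨y, hy⟩
      obtain ⟨i, hi⟩ : y - y₀ ∈ LinearMap.range (Algebra.linearMap (ZMod p) E) := by
        rw [← ker_wp, LinearMap.mem_ker, map_sub, wp_apply, wp_apply, hy, h, sub_self]
      refine ⟨i, Subtype.ext ?_⟩
      change algebraMap (ZMod p) E i = y - y₀ at hi
      simp [hi]
  rw [← Nat.card_congr e, Nat.card_zmod]

/-- Additive Hilbert 90 over the prime field. -/
theorem range_wp [Finite E] :
    LinearMap.range (wp p E) = LinearMap.ker (Algebra.trace (ZMod p) E) := by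
  refine Submodule.eq_of_le_of_finrank_eq ?_ ?_
  · rintro _ ⟨y, rfl⟩
    rw [LinearMap.mem_ker, wp_apply, map_sub, sub_eq_zero]
    have h := Algebra.trace_eq_of_algEquiv
      (FiniteField.frobeniusAlgEquivOfAlgebraic (ZMod p) E) y
    simpa [ZMod.card] using h
  · have h1 := LinearMap.finrank_range_add_finrank_ker (wp p E)
    have h2 := LinearMap.finrank_range_add_finrank_ker (Algebra.trace (ZMod p) E)
    have h3 := LinearMap.finrank_range_of_inj (f := Algebra.linearMap (ZMod p) E)
      (algebraMap (ZMod p) E).injective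
    rw [ker_wp, h3, Module.finrank_self] at h1
    rw [LinearMap.range_eq_top.2 (Algebra.trace_surjective (ZMod p) E), finrank_top,
      Module.finrank_self] at h2
    omega

theorem natCard_wp_eq [Finite E] (c : E) : Nat.card {y : E // y ^ p - y = c} =
    if Algebra.trace (ZMod p) E c = 0 then p else 0 := by
  split_ifs with h
  · rw [← LinearMap.mem_ker, ← range_wp] at h
    obtain ⟨y, hy⟩ := h
    exact natCard_wp_fiber hy
  · rw [Nat.card_eq_zero]
    refine Or.inl ⟨fun y => h ?_⟩
    rw [← LinearMap.mem_ker, ← range_wp]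
    exact ⟨y.1, y.2⟩

/-- If a finite set is stable under a translation that changes the trace of `ev`, then all values
of this trace are taken equally often, so that `y ^ p - y = ev g` has one solution on average. -/
theorem sum_natCard_wp_of_translation [Finite E] {A : Type*} [AddCommGroup A] (G : Finset A)
    (ev : A →+ E) (τ : A) (hτ : ∀ g ∈ G, g + τ ∈ G)
    (htr : Algebra.trace (ZMod p) E (ev τ) ≠ 0) :
    ∑ g ∈ G, Nat.card {y : E // y ^ p - y = ev g} = G.card := by
  classical
  set T : A → ZMod p := fun g => Algebra.trace (ZMod p) E (ev g) with hT
  have hTadd : ∀ g, T (g + τ) = T g + T τ := fun g => by simp [hT]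
  have hinj : Function.Injective fun g : A => g + τ := add_left_injective τ
  have hle : ∀ i, (G.filter fun g => T g = i).card ≤
      (G.filter fun g => T g = i + T τ).card := fun i => by
    refine Finset.card_le_card_of_injOn (fun g => g + τ) ?_ hinj.injOn
    intro g hg
    simp only [Finset.coe_filter, Set.mem_ofPred_eq] at hg ⊢
    exact ⟨hτ g hg.1, by rw [hTadd, hg.2]⟩
  have hle' : ∀ (n : ℕ) i, (G.filter fun g => T g = i).card ≤
      (G.filter fun g => T g = i + n * T τ).card := by
    intro n
    induction n with
    | zero => intro i; simp
    | succ n ih =>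
      intro i
      refine (ih i).trans ((hle _).trans_eq ?_)
      congr 2
      ext; push_cast; rw [add_assoc, add_mul, one_mul]
  have hall : ∀ i j, (G.filter fun g => T g = i).card ≤ (G.filter fun g => T g = j).card := by
    intro i j
    have := hle' ((j - i) / T τ).val i
    rwa [ZMod.natCast_zmod_val, div_mul_cancel₀ _ htr, add_sub_cancel] at this
  have hsum : G.card = ∑ i : ZMod p, (G.filter fun g => T g = i).card :=
    Finset.card_eq_sum_card_fiberwise (fun _ _ => Finset.mem_coe.2 (Finset.mem_univ _))
  rw [Finset.sum_congr rfl fun i _ => le_antisymm (hall i 0) (hall 0 i), Finset.sum_const,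
    Finset.card_univ, ZMod.card, smul_eq_mul] at hsum
  simp_rw [natCard_wp_eq]
  rw [← Finset.sum_filter, Finset.sum_const, smul_eq_mul, hsum, mul_comm]

section Tower

variable {M : Type*} [Field M] [Algebra (ZMod p) M] [Algebra M E] [Finite E]

theorem trace_algebraMap_eq (m : M) : Algebra.trace (ZMod p) E (algebraMap M E m) =
    Module.finrank M E * Algebra.trace (ZMod p) M m := by
  have : Finite M := Finite.of_injective _ (algebraMap M E).injective
  have : IsScalarTower (ZMod p) M E :=
    IsScalarTower.of_algebraMap_eq' (Subsingleton.elim _ _)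
  rw [← Algebra.trace_trace (S := M), Algebra.trace_algebraMap, map_nsmul, nsmul_eq_mul]

theorem trace_algebraMap_eq_zero (h : p ∣ Module.finrank M E) (m : M) :
    Algebra.trace (ZMod p) E (algebraMap M E m) = 0 := by
  rw [trace_algebraMap_eq, (ZMod.natCast_eq_zero_iff _ _).2 h, zero_mul]

theorem exists_trace_algebraMap_ne_zero (h : ¬ p ∣ Module.finrank M E) :
    ∃ m : M, Algebra.trace (ZMod p) E (algebraMap M E m) ≠ 0 := by
  have : Finite M := Finite.of_injective _ (algebraMap M E).injective
  obtain ⟨m, hm⟩ := Algebra.trace_surjective (ZMod p) M 1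
  refine ⟨m, ?_⟩
  rw [trace_algebraMap_eq, hm, mul_one, Ne, ZMod.natCast_eq_zero_iff]
  exact h

end Tower

end FiniteFields

/-! ### Irreducibility of the Artin–Schreier equation -/

section Irreducibility

theorem natDegree_X_pow_sub_X_sub_C {K : Type*} [Field K] {p : ℕ} (hp : 1 < p) (c : K) :
    (X ^ p - X - C c).natDegree = p := by
  rw [natDegree_sub_C, FiniteField.X_pow_card_sub_X_natDegree_eq K hp]

theorem monic_X_pow_sub_X_sub_C {K : Type*} [Field K] {p : ℕ} (hp : 1 < p) (c : K) :
    (X ^ p - X - C c).Monic := by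
  rw [sub_sub]
  refine monic_X_pow_sub ((degree_add_le _ _).trans_lt (max_lt ?_ ?_))
  · rw [degree_X]; exact_mod_cast hp
  · exact degree_C_le.trans_lt (by exact_mod_cast (by omega : 0 < p))

/-- The roots of a factor of degree `m` differ by elements of the prime field, so that
`m` times one of them is rational. -/
theorem irreducible_X_pow_sub_X_sub_C {K : Type*} [Field K] {p : ℕ} [Fact p.Prime] [CharP K p]
    {c : K} (hc : ∀ r : K, r ^ p - r ≠ c) : Irreducible (X ^ p - X - C c) := by
  have hp : 1 < p := (Fact.out : p.Prime).one_lt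
  have hm := monic_X_pow_sub_X_sub_C hp c
  have hdeg := natDegree_X_pow_sub_X_sub_C hp c
  rw [hm.irreducible_iff_natDegree']
  refine ⟨fun h => by rw [h, natDegree_one] at hdeg; omega, ?_⟩
  intro g' g _ hgm hgg' hg
  rw [Finset.mem_Ioc, hdeg] at hg
  let _ := ZMod.algebra K p
  let Ω := AlgebraicClosure K
  have hchar : CharP Ω p := charP_of_injective_algebraMap (algebraMap K Ω).injective p
  let _ := ZMod.algebra Ω p
  have hsplit : (g.map (algebraMap K Ω)).Splits := IsAlgClosed.splits _
  have hroot : ∀ ρ ∈ (g.map (algebraMap K Ω)).roots, ρ ^ p - ρ = algebraMap K Ω c := by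
    intro ρ hρ
    rw [mem_roots (map_ne_zero hgm.ne_zero)] at hρ
    have h : eval ρ ((X ^ p - X - C c).map (algebraMap K Ω)) = 0 := by
      rw [← hgg', Polynomial.map_mul, eval_mul, hρ, mul_zero]
    simpa [sub_eq_zero] using h
  have hcard := hsplit.natDegree_eq_card_roots
  rw [natDegree_map] at hcard
  obtain ⟨ρ, hρ⟩ : ∃ ρ, ρ ∈ (g.map (algebraMap K Ω)).roots :=
    Multiset.card_pos_iff_exists_mem.1 (by omega)
  have hdiff : ∀ x ∈ (g.map (algebraMap K Ω)).roots, ∃ i : K, x = ρ + algebraMap K Ω i := by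
    intro x hx
    have h : (x - ρ) ^ p = x - ρ := by
      rw [sub_pow_char]
      linear_combination hroot x hx - hroot ρ hρ
    obtain ⟨i, hi⟩ := pow_char_eq_self_iff.1 h
    refine ⟨algebraMap (ZMod p) K i, ?_⟩
    have : algebraMap K Ω (algebraMap (ZMod p) K i) = algebraMap (ZMod p) Ω i :=
      RingHom.congr_fun (Subsingleton.elim ((algebraMap K Ω).comp (algebraMap (ZMod p) K)) _) i
    rw [this, hi]; ring
  have hsum : ∀ s : Multiset Ω, (∀ x ∈ s, ∃ i : K, x = ρ + algebraMap K Ω i) →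
      ∃ i : K, s.sum = s.card * ρ + algebraMap K Ω i := by
    intro s
    induction s using Multiset.induction with
    | empty => intro _; exact ⟨0, by simp⟩
    | cons x s ih =>
      intro h
      obtain ⟨i, hi⟩ := ih fun y hy => h y (Multiset.mem_cons_of_mem hy)
      obtain ⟨j, hj⟩ := h x (Multiset.mem_cons_self x s)
      refine ⟨i + j, ?_⟩
      rw [Multiset.sum_cons, hi, hj, Multiset.card_cons, map_add]
      push_cast; ring
  obtain ⟨i, hi⟩ := hsum _ hdiff
  rw [← hcard] at hi
  have hnext := hsplit.nextCoeff_eq_neg_sum_roots_of_monic (hgm.map _)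
  rw [nextCoeff_map (algebraMap K Ω).injective, hi] at hnext
  have hne : (g.natDegree : K) ≠ 0 := by
    rw [Ne, CharP.cast_eq_zero_iff K p]
    exact Nat.not_dvd_of_pos_of_lt hg.1 (by omega)
  have hne' : (g.natDegree : Ω) ≠ 0 := by
    rw [← map_natCast (algebraMap K Ω)]
    exact (_root_.map_ne_zero _).2 hne
  have hρ' : ρ = algebraMap K Ω (-(g.nextCoeff + i) / g.natDegree) := by
    rw [map_div₀, map_neg, map_add, map_natCast, eq_div_iff hne', hnext]
    ring
  refine hc (-(g.nextCoeff + i) / g.natDegree) ((algebraMap K Ω).injective ?_)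
  rw [map_sub, map_pow, ← hρ', hroot ρ hρ]

theorem pow_eq_of_pow_mul_eq {R : Type*} [CommRing R] [IsDomain R] {P A B : R} {m n : ℕ}
    (hP0 : P ≠ 0) (hA : ¬ P ∣ A) (hB : ¬ P ∣ B) (h : P ^ m * A = P ^ n * B) : m = n := by
  rcases lt_trichotomy m n with hlt | heq | hlt
  · obtain ⟨e, rfl⟩ := Nat.exists_eq_add_of_lt hlt
    rw [add_assoc, pow_add, mul_assoc] at h
    exact absurd ⟨_, (mul_left_cancel₀ (pow_ne_zero _ hP0) h).trans
      (by rw [pow_succ', mul_assoc])⟩ hA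
  · exact heq
  · obtain ⟨e, rfl⟩ := Nat.exists_eq_add_of_lt hlt
    rw [add_assoc, pow_add, mul_assoc] at h
    exact absurd ⟨_, (mul_left_cancel₀ (pow_ne_zero _ hP0) h.symm).trans
      (by rw [pow_succ', mul_assoc])⟩ hB

variable {F : Type*} [Field F] {p : ℕ} {a b : F[X]}

theorem exists_num_denom_of_root (hp : 1 < p) (hb : b ≠ 0) {r : RatFunc F}
    (hr : r ^ p - r = algebraMap F[X] (RatFunc F) a / algebraMap F[X] (RatFunc F) b) :
    ∃ u s : F[X], s ≠ 0 ∧ IsCoprime u s ∧ b * (u ^ p - u * s ^ (p - 1)) = a * s ^ p := by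
  refine ⟨r.num, r.denom, r.denom_ne_zero, r.isCoprime_num_denom,
    IsFractionRing.injective F[X] (RatFunc F) ?_⟩
  have hs : algebraMap F[X] (RatFunc F) r.denom ≠ 0 := by simpa using r.denom_ne_zero
  have hb' : algebraMap F[X] (RatFunc F) b ≠ 0 := by simpa using hb
  have hr' := hr
  rw [← r.num_div_denom, eq_div_iff hb'] at hr'
  simp only [map_mul, map_sub, map_pow]
  rw [← hr']
  obtain ⟨n, rfl⟩ : ∃ n, p = n + 1 := ⟨p - 1, by omega⟩
  simp only [Nat.add_sub_cancel, div_pow]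
  field_simp
  ring

variable [Fact p.Prime] [CharP F p]

/-- A finite pole of order prime to `p`. -/
theorem irreducible_equation_of_pole {P w : F[X]} {n : ℕ} (hP : Prime P) (hb : b = P ^ n * w)
    (hw : ¬ P ∣ w) (ha : ¬ P ∣ a) (hn : ¬ p ∣ n) : Irreducible (equation p a b) := by
  have hp : 1 < p := (Fact.out : p.Prime).one_lt
  have : CharP (RatFunc F) p := charP_of_injective_algebraMap (algebraMap F (RatFunc F)).injective p
  have hw0 : w ≠ 0 := by rintro rfl; exact hw (dvd_zero _)
  refine irreducible_X_pow_sub_X_sub_C fun r hr => ?_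
  obtain ⟨u, s, hs0, hus, h⟩ := exists_num_denom_of_root hp
    (hb ▸ mul_ne_zero (pow_ne_zero _ hP.ne_zero) hw0) hr
  by_cases hs : P ∣ s
  · obtain ⟨s', hs, hs'⟩ :=
      (FiniteMultiplicity.of_prime_left hP hs0).exists_eq_pow_mul_and_not_dvd
    have hPs : P ∣ s := by assumption
    have hu : ¬ P ∣ u := fun hu => hP.not_isUnit (hus.isUnit_of_dvd' hu hPs)
    refine hn ⟨multiplicity P s, ?_⟩
    refine pow_eq_of_pow_mul_eq (A := w * (u ^ p - u * s ^ (p - 1))) (B := a * s' ^ p) hP.ne_zero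
      (fun hd => ?_) (fun hd => ?_) ?_
    · refine (hP.dvd_or_dvd hd).elim hw fun hd => hu (hP.dvd_of_dvd_pow (n := p) ?_)
      have h2 : P ∣ u * s ^ (p - 1) :=
        Dvd.dvd.mul_left (hPs.trans (dvd_pow_self _ (by omega))) _
      simpa using dvd_add hd h2
    · exact (hP.dvd_or_dvd hd).elim ha fun h => hs' (hP.dvd_of_dvd_pow h)
    · rw [← mul_assoc, ← hb, h, mul_comm p, pow_mul]
      conv_lhs => rw [hs, mul_pow]
      ring
  · have hn0 : n ≠ 0 := by rintro rfl; exact hn (dvd_zero _)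
    have hdvd : P ∣ a * s ^ p := by
      rw [← h, hb]
      exact Dvd.dvd.mul_right (Dvd.dvd.mul_right (dvd_pow_self _ hn0) _) _
    exact (hP.dvd_or_dvd hdvd).elim ha fun h => hs (hP.dvd_of_dvd_pow h)

/-- A pole at infinity of order prime to `p`. -/
theorem irreducible_equation_of_degree (hb : b ≠ 0) {n : ℕ}
    (hab : a.natDegree = b.natDegree + n) (hn : ¬ p ∣ n) : Irreducible (equation p a b) := by
  have hp : 1 < p := (Fact.out : p.Prime).one_lt
  have : CharP (RatFunc F) p := charP_of_injective_algebraMap (algebraMap F (RatFunc F)).injective p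
  have hn0 : n ≠ 0 := by rintro rfl; exact hn (dvd_zero _)
  have ha : a ≠ 0 := by rintro rfl; simp at hab; omega
  refine irreducible_X_pow_sub_X_sub_C fun r hr => ?_
  obtain ⟨u, s, hs0, -, h⟩ := exists_num_denom_of_root hp hb hr
  have hdeg := congrArg natDegree h
  rw [natDegree_mul ha (pow_ne_zero _ hs0), natDegree_pow] at hdeg
  obtain ⟨q, rfl⟩ : ∃ q, p = q + 1 := ⟨p - 1, by omega⟩
  simp only [Nat.add_sub_cancel] at *
  rcases le_or_gt u.natDegree s.natDegree with hus | hus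
  · have h1 : (u ^ (q + 1) - u * s ^ q).natDegree ≤ (q + 1) * s.natDegree := by
      refine (natDegree_sub_le _ _).trans (max_le ?_ ?_)
      · rw [natDegree_pow]; exact Nat.mul_le_mul_left _ hus
      · refine natDegree_mul_le.trans ?_
        rw [natDegree_pow]
        linarith
    have h2 := natDegree_mul_le (p := b) (q := u ^ (q + 1) - u * s ^ q)
    omega
  · have hu : u ≠ 0 := by rintro rfl; simp at hus
    have h1 : (u * s ^ q).natDegree < (u ^ (q + 1)).natDegree := by
      rw [natDegree_pow, natDegree_mul hu (pow_ne_zero _ hs0), natDegree_pow, add_mul, one_mul,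
        add_comm]
      have : q * s.natDegree < q * u.natDegree := Nat.mul_lt_mul_of_pos_left hus (by omega)
      omega
    have h2 := natDegree_sub_eq_left_of_natDegree_lt h1
    have h3 : u ^ (q + 1) - u * s ^ q ≠ 0 := by
      intro h0
      rw [h0, natDegree_zero] at h2
      omega
    rw [natDegree_mul hb h3, h2, natDegree_pow, hab] at hdeg
    refine hn ⟨u.natDegree - s.natDegree, ?_⟩
    rw [Nat.mul_sub]
    omega

end Irreducibility

/-! ### The coordinate ring and its points -/

section Points

variable {F : Type*} [Field F]

theorem exists_ringHom_comp_algebraMap_eq_of_injective {A O Ω : Type*} [CommRing A] [IsDomain A]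
    [CommRing O] [IsDomain O] [Algebra A O] [Algebra.IsIntegral A O] [Field Ω] [IsAlgClosed Ω]
    (hinj : Function.Injective (algebraMap A O)) (f : A →+* Ω) (hf : Function.Injective f) :
    ∃ ψ : O →+* Ω, ∀ r, ψ (algebraMap A O r) = f r := by
  let _ : Algebra A Ω := f.toAlgebra
  have : Module.IsTorsionFree A Ω := Module.isTorsionFree_iff_algebraMap_injective.2 hf
  have : Module.IsTorsionFree A O := Module.isTorsionFree_iff_algebraMap_injective.2 hinj
  have hext : ∃ ψ : O →ₐ[A] Ω, True := ⟨IsAlgClosed.lift, trivial⟩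
  obtain ⟨ψ, -⟩ := hext
  exact ⟨ψ, fun r => ψ.commutes r⟩

/-- A homomorphism to an algebraically closed field extends along an integral extension. -/
theorem exists_ringHom_comp_algebraMap_eq {A O Ω : Type*} [CommRing A] [CommRing O] [Algebra A O]
    [Algebra.IsIntegral A O] [Field Ω] [IsAlgClosed Ω]
    (hinj : Function.Injective (algebraMap A O)) (f : A →+* Ω) :
    ∃ ψ : O →+* Ω, ∀ r, ψ (algebraMap A O r) = f r := by
  have hprime : (RingHom.ker f).IsPrime := RingHom.ker_isPrime _
  obtain ⟨Q, -, hQ, hQf⟩ := Ideal.exists_ideal_over_prime_of_isIntegral (RingHom.ker f)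
    (⊥ : Ideal O)
    (by rw [← RingHom.ker_eq_comap_bot, (RingHom.injective_iff_ker_eq_bot _).1 hinj]; exact bot_le)
  have hlies : Q.LiesOver (RingHom.ker f) := ⟨hQf.symm⟩
  obtain ⟨ψ, hψ⟩ := exists_ringHom_comp_algebraMap_eq_of_injective
    (FaithfulSMul.algebraMap_injective (A ⧸ RingHom.ker f) (O ⧸ Q)) (RingHom.kerLift f)
    (RingHom.kerLift_injective f)
  exact ⟨ψ.comp (Ideal.Quotient.mk Q), fun r => hψ (Ideal.Quotient.mk (RingHom.ker f) r)⟩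

theorem exists_algHom_algebraMap_X_eq {O Ω : Type*} [CommRing O] [Algebra F[X] O] [Algebra F O]
    [IsScalarTower F F[X] O] [Algebra.IsIntegral F[X] O] [Field Ω] [IsAlgClosed Ω] [Algebra F Ω]
    (hinj : Function.Injective (algebraMap F[X] O)) (α : Ω) :
    ∃ φ : O →ₐ[F] Ω, φ (algebraMap F[X] O X) = α := by
  obtain ⟨ψ, hψ⟩ := exists_ringHom_comp_algebraMap_eq hinj
    ((aeval α : F[X] →ₐ[F] Ω) : F[X] →+* Ω)
  refine ⟨{ ψ with commutes' := fun r => ?_ }, ?_⟩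
  · change ψ (algebraMap F O r) = _
    rw [IsScalarTower.algebraMap_apply F F[X] O, hψ, ← C_eq_algebraMap]
    exact aeval_C _ _
  · change ψ (algebraMap F[X] O X) = _
    rw [hψ]
    exact aeval_X _

theorem exists_algHom_of_forall_mem_range {O E Ω : Type*} [CommRing O] [Algebra F O]
    [Field E] [Algebra F E] [Field Ω] [Algebra F Ω] [Algebra E Ω] [IsScalarTower F E Ω]
    (φ : O →ₐ[F] Ω) (h : ∀ x, φ x ∈ Set.range (algebraMap E Ω)) :
    ∃ ψ : O →ₐ[F] E, ∀ x, algebraMap E Ω (ψ x) = φ x := by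
  let e := AlgEquiv.ofInjectiveField (IsScalarTower.toAlgHom F E Ω)
  refine ⟨(e.symm : _ →ₐ[F] E).comp (φ.codRestrict (IsScalarTower.toAlgHom F E Ω).range h),
    fun x => ?_⟩
  have : e (e.symm (φ.codRestrict (IsScalarTower.toAlgHom F E Ω).range h x)) =
      φ.codRestrict (IsScalarTower.toAlgHom F E Ω).range h x := e.apply_symm_apply _
  exact congrArg Subtype.val this

theorem algHom_algebraMap {O Ω : Type*} [CommRing O] [Algebra F[X] O] [Algebra F O]
    [IsScalarTower F F[X] O] [CommRing Ω] [Algebra F Ω] (φ : O →ₐ[F] Ω) (r : F[X]) :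
    φ (algebraMap F[X] O r) = aeval (φ (algebraMap F[X] O X)) r := by
  have : φ.comp (IsScalarTower.toAlgHom F F[X] O) = aeval (φ (algebraMap F[X] O X)) := by
    ext; simp
  exact DFunLike.congr_fun this r

end Points

section Fibers

variable {F : Type*} [Field F] {p : ℕ} [Fact p.Prime] [CharP F p] {a b : F[X]}

omit [Fact p.Prime] [CharP F p] in
theorem algebraMap_functionField_injective [Fact (Irreducible (equation p a b))] :
    Function.Injective (algebraMap F[X] (FunctionField p a b)) := by
  rw [IsScalarTower.algebraMap_eq F[X] (RatFunc F) (FunctionField p a b)]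
  exact (algebraMap (RatFunc F) _).injective.comp (IsFractionRing.injective F[X] (RatFunc F))

omit [Fact p.Prime] [CharP F p] in
theorem algebraMap_coordinateRing_injective [Fact (Irreducible (equation p a b))] :
    Function.Injective (algebraMap F[X] (CoordinateRing p a b)) := by
  intro x y h
  exact algebraMap_functionField_injective (p := p) (a := a) (b := b) (congrArg Subtype.val h)

omit [CharP F p] in
theorem monic_equation : (equation p a b).Monic :=
  monic_X_pow_sub_X_sub_C (Fact.out : p.Prime).one_lt _

omit [CharP F p] in
theorem natDegree_equation : (equation p a b).natDegree = p :=
  natDegree_X_pow_sub_X_sub_C (Fact.out : p.Prime).one_lt _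

omit [CharP F p] in
theorem finrank_functionField : Module.finrank (RatFunc F) (FunctionField p a b) = p := by
  rw [(AdjoinRoot.powerBasis (monic_equation (p := p) (a := a) (b := b)).ne_zero).finrank,
    AdjoinRoot.powerBasis_dim, natDegree_equation]

omit [Fact p.Prime] [CharP F p] in
theorem root_pow_sub_root : AdjoinRoot.root (equation p a b) ^ p - AdjoinRoot.root (equation p a b)
    = algebraMap (RatFunc F) (FunctionField p a b)
      (algebraMap F[X] (RatFunc F) a / algebraMap F[X] (RatFunc F) b) := by
  have h := AdjoinRoot.eval₂_root (equation p a b)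
  conv at h =>
    enter [1, 3]
    rw [equation]
  rw [eval₂_sub, eval₂_sub, eval₂_pow, eval₂_X, eval₂_C] at h
  exact sub_eq_zero.1 h

theorem isSeparable_functionField [Fact (Irreducible (equation p a b))] :
    Algebra.IsSeparable (RatFunc F) (FunctionField p a b) := by
  have : CharP (RatFunc F) p := charP_of_injective_algebraMap (algebraMap F (RatFunc F)).injective p
  have hsep : IsSeparable (RatFunc F) (AdjoinRoot.root (equation p a b)) := by
    rw [IsSeparable, AdjoinRoot.minpoly_root monic_equation.ne_zero, monic_equation.leadingCoeff,
      inv_one, C_1, mul_one]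
    exact ⟨0, -1, by simp [equation, derivative_X_pow]⟩
  have h := (IntermediateField.isSeparable_adjoin_simple_iff_isSeparable _ _).2 hsep
  rw [IntermediateField.adjoin_root_eq_top] at h
  exact Algebra.IsSeparable.of_algHom _ _
    (IntermediateField.topEquiv (F := RatFunc F) (E := FunctionField p a b)).symm.toAlgHom

/-- The integral generator `b y` of the function field. -/
def integralGen (p : ℕ) (a b : F[X]) : FunctionField p a b :=
  algebraMap F[X] (FunctionField p a b) b * AdjoinRoot.root (equation p a b)

omit [CharP F p] in
theorem integralGen_pow (hb : b ≠ 0) :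
    integralGen p a b ^ p - algebraMap F[X] (FunctionField p a b) (b ^ (p - 1)) * integralGen p a b
      = algebraMap F[X] (FunctionField p a b) (a * b ^ (p - 1)) := by
  obtain ⟨q, hq⟩ : ∃ q, p = q + 1 := ⟨p - 1, by have := (Fact.out : p.Prime).pos; omega⟩
  have hb' : algebraMap F[X] (RatFunc F) b ≠ 0 := by simpa using hb
  have h := root_pow_sub_root (p := p) (a := a) (b := b)
  have h2 : algebraMap F[X] (RatFunc F) a / algebraMap F[X] (RatFunc F) b *
      algebraMap F[X] (RatFunc F) b = algebraMap F[X] (RatFunc F) a := div_mul_cancel₀ _ hb'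
  have h3 := congrArg (algebraMap (RatFunc F) (FunctionField p a b)) h2
  rw [map_mul, ← h, ← IsScalarTower.algebraMap_apply, ← IsScalarTower.algebraMap_apply] at h3
  rw [integralGen, map_mul, ← h3, mul_pow, map_pow]
  have h4 : algebraMap F[X] (FunctionField p a b) b ^ p =
    algebraMap F[X] (FunctionField p a b) b ^ (p - 1) *
      algebraMap F[X] (FunctionField p a b) b := by
    rw [← pow_succ, show p - 1 + 1 = p by omega]
  rw [h4]
  ring

omit [CharP F p] in
theorem isIntegral_integralGen (hb : b ≠ 0) : IsIntegral F[X] (integralGen p a b) := by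
  have hp : 1 < p := (Fact.out : p.Prime).one_lt
  refine ⟨X ^ p - (C (b ^ (p - 1)) * X + C (a * b ^ (p - 1))), monic_X_pow_sub ?_, ?_⟩
  · exact degree_linear_le.trans_lt (by exact_mod_cast hp)
  · rw [eval₂_sub, eval₂_add, eval₂_mul, eval₂_pow, eval₂_X, eval₂_C, eval₂_C,
      ← integralGen_pow hb]
    ring

omit [CharP F p] in
/-- The discriminant of a root of `X ^ p - β X - γ` is, up to sign, `β ^ p` in
characteristic `p`. -/
theorem pow_mul_mem_adjoin {R K L : Type*} [CommRing R] [IsIntegrallyClosed R] [Field K]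
    [Algebra R K] [IsFractionRing R K] [CharP K p] [Field L] [Algebra K L] [Algebra R L]
    [IsScalarTower R K L] [Module.Finite K L] [Algebra.IsSeparable K L]
    (hrank : Module.finrank K L = p) {w : L} (hadj : Algebra.adjoin K {w} = ⊤) {β γ : R}
    (hw : w ^ p - algebraMap R L β * w = algebraMap R L γ) (hwint : IsIntegral R w) {z : L}
    (hz : IsIntegral R z) : algebraMap R L β ^ p * z ∈ Algebra.adjoin R {w} := by
  have hp : 1 < p := (Fact.out : p.Prime).one_lt
  have hint : IsIntegral K w := Algebra.IsIntegral.isIntegral w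
  let B := PowerBasis.ofAdjoinEqTop hint hadj
  have hgen : B.gen = w := PowerBasis.ofAdjoinEqTop_gen hint hadj
  have hmin : minpoly K w = X ^ p - (C (algebraMap R K β) * X + C (algebraMap R K γ)) := by
    have hmonic : (X ^ p - (C (algebraMap R K β) * X + C (algebraMap R K γ))).Monic :=
      monic_X_pow_sub (degree_linear_le.trans_lt (by exact_mod_cast hp))
    have hdeg : (X ^ p - (C (algebraMap R K β) * X + C (algebraMap R K γ))).natDegree = p := by
      refine (natDegree_sub_eq_left_of_natDegree_lt ?_).trans (natDegree_X_pow p)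
      rw [natDegree_X_pow]
      exact natDegree_linear_le.trans_lt hp
    refine (eq_of_monic_of_dvd_of_natDegree_le (minpoly.monic hint) hmonic
      (minpoly.dvd _ _ ?_) ?_).symm
    · simp only [map_sub, map_add, map_mul, map_pow, aeval_X, aeval_C,
        ← IsScalarTower.algebraMap_apply]
      rw [← hw]; ring
    · rw [hdeg, ← hgen, PowerBasis.natDegree_minpoly, ← B.finrank, hrank]
  obtain ⟨e, he⟩ : ∃ e : ℕ, Algebra.discr K B.basis = algebraMap R K ((-1) ^ e * β ^ p) := by
    refine ⟨p * (p - 1) / 2 + p, ?_⟩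
    have hder : derivative (X ^ p - (C (algebraMap R K β) * X + C (algebraMap R K γ))) =
        C (-algebraMap R K β) := by simp [derivative_X_pow]
    rw [Algebra.discr_powerBasis_eq_norm, hgen, hmin, hder, aeval_C, Algebra.norm_algebraMap,
      hrank, neg_pow, pow_add]
    simp only [map_mul, map_pow, map_neg, map_one]
    ring
  have h := Algebra.discr_mul_isIntegral_mem_adjoin K (R := R) (B := B) (hgen ▸ hwint) hz
  rw [he, hgen, Algebra.smul_def, ← IsScalarTower.algebraMap_apply, map_mul, map_pow, map_pow,
    map_neg, map_one, mul_assoc] at h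
  have h2 := mul_mem (pow_mem (neg_mem (one_mem (Algebra.adjoin R {w}))) e) h
  rwa [← mul_assoc, ← mul_pow, neg_one_mul, neg_neg, one_pow, one_mul] at h2

/-- Away from the zeros of `b` the coordinate ring is generated by `b y`. -/
theorem exists_pow_mul_mem_adjoin [Fact (Irreducible (equation p a b))] (hb : b ≠ 0) :
    ∃ N : ℕ, ∀ z : FunctionField p a b, IsIntegral F[X] z →
      algebraMap F[X] (FunctionField p a b) (b ^ N) * z ∈
        Algebra.adjoin F[X] {integralGen p a b} := by
  have := isSeparable_functionField (p := p) (a := a) (b := b)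
  have : CharP (RatFunc F) p := charP_of_injective_algebraMap (algebraMap F (RatFunc F)).injective p
  have hfin : Module.Finite (RatFunc F) (FunctionField p a b) :=
    (AdjoinRoot.powerBasis (monic_equation (p := p) (a := a) (b := b)).ne_zero).finite
  have hb' : algebraMap F[X] (RatFunc F) b ≠ 0 := by simpa using hb
  have hadj : Algebra.adjoin (RatFunc F) {integralGen p a b} = ⊤ := by
    rw [eq_top_iff, ← AdjoinRoot.adjoinRoot_eq_top]
    refine Algebra.adjoin_le (Set.singleton_subset_iff.2 ?_)
    have : AdjoinRoot.root (equation p a b) =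
        algebraMap (RatFunc F) (FunctionField p a b) (algebraMap F[X] (RatFunc F) b)⁻¹ *
          integralGen p a b := by
      rw [integralGen, IsScalarTower.algebraMap_apply F[X] (RatFunc F) (FunctionField p a b),
        ← mul_assoc, ← map_mul, inv_mul_cancel₀ hb', map_one, one_mul]
    rw [this]
    exact mul_mem (Subalgebra.algebraMap_mem _ _) (Algebra.subset_adjoin rfl)
  refine ⟨(p - 1) * p, fun z hz => ?_⟩
  rw [pow_mul, map_pow]
  exact pow_mul_mem_adjoin finrank_functionField hadj (integralGen_pow hb)
    (isIntegral_integralGen hb) hz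

end Fibers

/-! ### Fibres away from the poles -/

section Unramified

variable {F : Type*} [Field F] {p : ℕ} [Fact p.Prime] [CharP F p] {a b : F[X]}

/-- The element `b y` of the coordinate ring. -/
def coordinateGen (a : F[X]) (hb : b ≠ 0) : CoordinateRing p a b :=
  ⟨integralGen p a b, isIntegral_integralGen hb⟩

omit [CharP F p] in
theorem coordinateGen_pow (hb : b ≠ 0) :
    (coordinateGen a hb : CoordinateRing p a b) ^ p -
      algebraMap F[X] (CoordinateRing p a b) (b ^ (p - 1)) * coordinateGen a hb =
      algebraMap F[X] (CoordinateRing p a b) (a * b ^ (p - 1)) :=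
  Subtype.ext (integralGen_pow hb)

theorem exists_pow_mul_eq_eval₂ [Fact (Irreducible (equation p a b))] (hb : b ≠ 0) :
    ∃ N : ℕ, ∀ x : CoordinateRing p a b, ∃ q : F[X][X],
      algebraMap F[X] (CoordinateRing p a b) (b ^ N) * x =
        q.eval₂ (algebraMap F[X] (CoordinateRing p a b)) (coordinateGen a hb) := by
  obtain ⟨N, hN⟩ := exists_pow_mul_mem_adjoin (p := p) (a := a) hb
  refine ⟨N, fun x => ?_⟩
  have h := hN x.1 x.2
  rw [Algebra.adjoin_singleton_eq_range_aeval] at h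
  obtain ⟨q, hq⟩ := h
  refine ⟨q, Subtype.ext ?_⟩
  have h2 := hom_eval₂ q (algebraMap F[X] (CoordinateRing p a b))
    (integralClosure F[X] (FunctionField p a b)).val.toRingHom (coordinateGen a hb)
  exact hq.symm.trans h2.symm

/-- The automorphism `y ↦ y + i` of the function field, for `i` in the prime field. -/
theorem exists_algHom_coordinateGen_add (hb : b ≠ 0) {i : F} (hi : i ^ p = i) :
    ∃ σ : CoordinateRing p a b →ₐ[F[X]] CoordinateRing p a b,
      σ (coordinateGen a hb) = coordinateGen a hb + algebraMap F[X] _ (b * C i) := by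
  have : CharP (FunctionField p a b) p := by
    have : Nontrivial (FunctionField p a b) := AdjoinRoot.nontrivial _ (by
      rw [degree_eq_natDegree monic_equation.ne_zero, natDegree_equation]
      exact_mod_cast (Fact.out : p.Prime).ne_zero)
    exact charP_of_injective_algebraMap (algebraMap F (FunctionField p a b)).injective p
  let τ : FunctionField p a b →ₐ[RatFunc F] FunctionField p a b :=
    AdjoinRoot.liftAlgHom (equation p a b) (Algebra.ofId _ _)
      (AdjoinRoot.root (equation p a b) + algebraMap F (FunctionField p a b) i) (by
        have h := root_pow_sub_root (p := p) (a := a) (b := b)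
        change eval₂ _ _ (X ^ p - X -
          C (algebraMap F[X] (RatFunc F) a / algebraMap F[X] (RatFunc F) b)) = 0
        rw [eval₂_sub, eval₂_sub, eval₂_pow, eval₂_X, eval₂_C, add_pow_char, ← map_pow,
          hi, add_sub_add_right_eq_sub]
        exact sub_eq_zero.2 h)
  refine ⟨(τ.restrictScalars F[X]).mapIntegralClosure, Subtype.ext ?_⟩
  change τ (algebraMap F[X] (FunctionField p a b) b * AdjoinRoot.root (equation p a b)) =
    algebraMap F[X] (FunctionField p a b) b * AdjoinRoot.root (equation p a b) +
      algebraMap F[X] (FunctionField p a b) (b * C i)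
  have h1 : τ (AdjoinRoot.root (equation p a b)) =
      AdjoinRoot.root (equation p a b) + algebraMap F (FunctionField p a b) i :=
    AdjoinRoot.liftAlgHom_root ..
  have h2 : τ (algebraMap F[X] (FunctionField p a b) b) = algebraMap F[X] (FunctionField p a b) b :=
    (τ.restrictScalars F[X]).commutes b
  rw [map_mul, h1, h2, map_mul, C_eq_algebraMap, ← IsScalarTower.algebraMap_apply, mul_add]

variable {E : Type*} [Field E] [Algebra F E] {α : E}

omit [CharP F p] in
theorem coordinateGen_div_pow (hb : b ≠ 0) (φ : CoordinateRing p a b →ₐ[F] E)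
    (hα : φ (algebraMap F[X] _ X) = α) (hbα : aeval α b ≠ 0) :
    (φ (coordinateGen a hb) / aeval α b) ^ p - φ (coordinateGen a hb) / aeval α b =
      aeval α a / aeval α b := by
  have h := congrArg φ (coordinateGen_pow (p := p) (a := a) hb)
  have hev : ∀ r : F[X], φ (algebraMap F[X] _ r) = aeval α r := fun r => by
    rw [algHom_algebraMap, hα]
  rw [map_sub, map_mul φ, map_pow φ, hev, hev, map_mul, map_pow] at h
  obtain ⟨q, hq⟩ : ∃ q, p = q + 1 := ⟨p - 1, by have := (Fact.out : p.Prime).pos; omega⟩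
  have h4 : aeval α b ^ p = aeval α b ^ (p - 1) * aeval α b := by
    rw [← pow_succ, show p - 1 + 1 = p by omega]
  have h5 : φ (coordinateGen a hb) ^ p =
      aeval α b ^ (p - 1) * (aeval α a + φ (coordinateGen a hb)) := by linear_combination h
  rw [div_pow, h4, h5, mul_div_mul_left _ _ (pow_ne_zero _ hbα), ← sub_div, add_sub_cancel_right]

/-- The fibre over a point that is not a pole. -/
theorem nonempty_fiber_equiv [Fact (Irreducible (equation p a b))] (hbα : aeval α b ≠ 0) :
    Nonempty ({φ : AffinePoints p a b E // φ (algebraMap F[X] (CoordinateRing p a b) X) = α} ≃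
      {y : E // y ^ p - y = aeval α a / aeval α b}) := by
  have hb : b ≠ 0 := by rintro rfl; simp at hbα
  obtain ⟨N, hN⟩ := exists_pow_mul_eq_eval₂ (p := p) (a := a) hb
  refine ⟨Equiv.ofBijective
    (fun φ => ⟨φ.1 (coordinateGen a hb) / aeval α b, coordinateGen_div_pow hb φ.1 φ.2 hbα⟩)
    ⟨?_, ?_⟩⟩
  · rintro ⟨φ, hφ⟩ ⟨ψ, hψ⟩ h
    have h' : φ (coordinateGen a hb) = ψ (coordinateGen a hb) := by
      have := congrArg Subtype.val h
      simpa [div_left_inj' hbα] using this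
    refine Subtype.ext (AlgHom.ext fun x => ?_)
    obtain ⟨q, hq⟩ := hN x
    have key : ∀ χ : CoordinateRing p a b →ₐ[F] E, χ (algebraMap F[X] _ X) = α →
        aeval α b ^ N * χ x =
          q.eval₂ (aeval α : F[X] →ₐ[F] E).toRingHom (χ (coordinateGen a hb)) := by
      intro χ hχ
      have h1 := congrArg χ hq
      rw [map_mul, algHom_algebraMap, hχ, map_pow] at h1
      rw [h1]
      refine (hom_eval₂ q _ χ.toRingHom _).trans ?_
      rw [show χ.toRingHom.comp (algebraMap F[X] (CoordinateRing p a b)) =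
        (aeval α : F[X] →ₐ[F] E).toRingHom from
          RingHom.ext fun r => (algHom_algebraMap χ r).trans (by rw [hχ]; rfl)]
      rfl
    refine mul_left_cancel₀ (pow_ne_zero N hbα) ?_
    rw [key φ hφ, key ψ hψ, h']
  -- The automorphisms `y ↦ y + i` carry any point over the algebraic closure to the solution `y`.
  · rintro ⟨y, hy⟩
    let Ω := AlgebraicClosure E
    have : CharP Ω p := charP_of_injective_algebraMap (algebraMap F Ω).injective p
    let _ := ZMod.algebra Ω p
    let _ := ZMod.algebra F p
    obtain ⟨φ, hφ⟩ := exists_algHom_algebraMap_X_eq (F := F)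
      (algebraMap_coordinateRing_injective (p := p) (a := a) (b := b)) (algebraMap E Ω α)
    have hbα' : aeval (algebraMap E Ω α) b ≠ 0 := by
      rw [aeval_algebraMap_apply]
      exact (_root_.map_ne_zero _).2 hbα
    have h1 := coordinateGen_div_pow hb φ hφ hbα'
    rw [aeval_algebraMap_apply, aeval_algebraMap_apply, ← map_div₀, ← hy] at h1
    set y₁ := φ (coordinateGen a hb) / algebraMap E Ω (aeval α b) with hy₁
    obtain ⟨j, hj⟩ := pow_char_eq_self_iff.1
      (show (algebraMap E Ω y - y₁) ^ p = algebraMap E Ω y - y₁ by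
        rw [sub_pow_char]
        rw [map_sub, map_pow] at h1
        linear_combination -h1)
    obtain ⟨σ, hσ⟩ := exists_algHom_coordinateGen_add (p := p) (a := a) hb
      (i := algebraMap (ZMod p) F j) (pow_char_eq_self_iff.2 ⟨j, rfl⟩)
    have hj' : algebraMap F Ω (algebraMap (ZMod p) F j) = algebraMap (ZMod p) Ω j :=
      RingHom.congr_fun (Subsingleton.elim ((algebraMap F Ω).comp (algebraMap (ZMod p) F)) _) j
    let φ' : CoordinateRing p a b →ₐ[F] Ω := φ.comp (σ.restrictScalars F)
    have hφ'X : φ' (algebraMap F[X] _ X) = algebraMap E Ω α := by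
      change φ (σ (algebraMap F[X] _ X)) = _
      rw [σ.commutes, hφ]
    have hφ'gen : φ' (coordinateGen a hb) = algebraMap E Ω (y * aeval α b) := by
      change φ (σ (coordinateGen a hb)) = _
      rw [hσ, map_add, algHom_algebraMap, hφ, map_mul, aeval_C, hj', hj, aeval_algebraMap_apply,
        hy₁, map_mul]
      have : algebraMap E Ω (aeval α b) ≠ 0 := (_root_.map_ne_zero _).2 hbα
      rw [mul_sub, mul_div_cancel₀ _ this]
      ring
    obtain ⟨ψ, hψ⟩ := exists_algHom_of_forall_mem_range (E := E) φ' (by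
      intro x
      obtain ⟨q, hq⟩ := hN x
      refine ⟨q.eval₂ (aeval α : F[X] →ₐ[F] E).toRingHom (y * aeval α b) / aeval α b ^ N, ?_⟩
      have h2 := congrArg φ' hq
      rw [map_mul, algHom_algebraMap, hφ'X, map_pow, aeval_algebraMap_apply] at h2
      have h3 : φ' (q.eval₂ (algebraMap F[X] (CoordinateRing p a b)) (coordinateGen a hb)) =
          algebraMap E Ω (q.eval₂ (aeval α : F[X] →ₐ[F] E).toRingHom (y * aeval α b)) := by
        refine (hom_eval₂ q _ φ'.toRingHom _).trans ?_
        rw [hom_eval₂, show φ'.toRingHom.comp (algebraMap F[X] (CoordinateRing p a b)) =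
          (algebraMap E Ω).comp (aeval α : F[X] →ₐ[F] E).toRingHom from
            RingHom.ext fun r => (algHom_algebraMap φ' r).trans (by
              rw [hφ'X, aeval_algebraMap_apply]; rfl), ← hφ'gen]
        rfl
      rw [map_div₀, ← h3, ← h2, map_pow]
      have : algebraMap E Ω (aeval α b) ≠ 0 := (_root_.map_ne_zero _).2 hbα
      rw [mul_div_cancel_left₀ _ (pow_ne_zero _ this)])
    refine ⟨⟨ψ, (algebraMap E Ω).injective ?_⟩, Subtype.ext ?_⟩
    · rw [hψ, hφ'X]
    · refine (algebraMap E Ω).injective ?_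
      change algebraMap E Ω (ψ (coordinateGen a hb) / aeval α b) = _
      rw [map_div₀, hψ, hφ'gen, ← map_div₀, mul_div_cancel_right₀ _ hbα]

end Unramified

/-! ### Fibres over the poles -/

section Ramified

/-- The valuation ring of a place of `K` above a point of the subring `O`. -/
theorem exists_valuationSubring_of_ringHom {O K Ω : Type*} [CommRing O] [Field K] [Algebra O K]
    [Field Ω] (hinj : Function.Injective (algebraMap O K)) (φ : O →+* Ω) :
    ∃ V : ValuationSubring K, ∀ x : O, V.valuation (algebraMap O K x) ≤ 1 ∧
      (V.valuation (algebraMap O K x) < 1 ↔ φ x = 0) := by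
  have hprime : (RingHom.ker φ).IsPrime := RingHom.ker_isPrime _
  let R := Localization.AtPrime (RingHom.ker φ)
  have hunit : ∀ x : (RingHom.ker φ).primeCompl, IsUnit (algebraMap O K x) := by
    rintro ⟨x, hx⟩
    refine isUnit_iff_ne_zero.2 fun h => hx ?_
    rw [← map_zero (algebraMap O K)] at h
    exact (hinj h : x = 0) ▸ zero_mem _
  let f : R →+* K := IsLocalization.lift (M := (RingHom.ker φ).primeCompl) hunit
  have hf : ∀ x : O, f (algebraMap O R x) = algebraMap O K x := IsLocalization.lift_eq hunit
  obtain ⟨V, hV, hloc⟩ := IsLocalRing.exists_factor_valuationRing f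
  refine ⟨V, fun x => ?_⟩
  have hmem : algebraMap O K x ∈ V := hf x ▸ hV (algebraMap O R x)
  refine ⟨(V.valuation_le_one_iff _).2 hmem, ?_⟩
  have h1 := V.valuation_lt_one_iff ⟨algebraMap O K x, hmem⟩
  have h2 : IsUnit (⟨algebraMap O K x, hmem⟩ : V) ↔ IsUnit (algebraMap O R x) := by
    have : (⟨algebraMap O K x, hmem⟩ : V) = f.codRestrict V.toSubring hV (algebraMap O R x) :=
      Subtype.ext (hf x).symm
    rw [this]
    exact isUnit_map_iff (f.codRestrict V.toSubring hV) _
  rw [← h1, IsLocalRing.mem_maximalIdeal, mem_nonunits_iff, h2,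
    IsLocalization.AtPrime.isUnit_to_map_iff R (RingHom.ker φ)]
  simp [Ideal.primeCompl, RingHom.mem_ker]

/-- If the value of `y` is, modulo the values of the ground field, of order `p`, then the terms of
a polynomial in `y` of degree less than `p` have distinct values, so that none of them exceeds the
value of their sum. -/
theorem valuation_aeval_sub_lt {p : ℕ} (hp : p.Prime) {k K Γ : Type*} [Field k] [Field K]
    [Algebra k K] [LinearOrderedCommGroupWithZero Γ] (v : Valuation K Γ) {π : Γ} (hπ0 : π ≠ 0)
    (hπ1 : π < 1) (hk : ∀ c : k, c ≠ 0 → ∃ m : ℤ, v (algebraMap k K c) = π ^ m) {y : K} {n : ℕ}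
    (hn : ¬ p ∣ n) (hy : v y ^ p * π ^ n = 1) {q : k[X]} (hq : q.natDegree < p)
    (hle : v (aeval y q) ≤ 1) :
    v (algebraMap k K (q.coeff 0)) ≤ 1 ∧
      v (aeval y q - algebraMap k K (q.coeff 0)) < 1 := by
  classical
  have hπpos : 0 < π := zero_lt_iff.2 hπ0
  have hzpow : Function.Injective fun m : ℤ => π ^ m := zpow_right_injective₀ hπpos hπ1.ne
  set T : ℕ → K := fun i => algebraMap k K (q.coeff i) * y ^ i with hT
  have hsum : aeval y q = ∑ i ∈ Finset.range p, T i := by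
    rw [aeval_eq_sum_range' hq]
    exact Finset.sum_congr rfl fun i _ => Algebra.smul_def _ _
  have hpow : ∀ i, T i ≠ 0 → ∃ m : ℤ, v (T i) ^ p = π ^ (p * m - n * i) := by
    intro i hi
    have hc : q.coeff i ≠ 0 := by
      intro h0
      exact hi (by simp [hT, h0])
    obtain ⟨m, hm⟩ := hk _ hc
    refine ⟨m, ?_⟩
    have hyp : v y ^ p = π ^ (-(n : ℤ)) := by
      rw [zpow_neg, zpow_natCast]
      exact eq_inv_of_mul_eq_one_left hy
    rw [hT, map_mul, map_pow, mul_pow, hm, ← pow_mul, mul_comm i, pow_mul, hyp, ← zpow_natCast,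
      ← zpow_mul, ← zpow_natCast, ← zpow_mul, ← zpow_add₀ hπ0]
    congr 1
    ring
  -- Equality of two values gives `p ∣ n * (j - i)`, and `p` is prime to `n`.
  have hdist : ∀ i < p, ∀ j < p, T i ≠ 0 → T j ≠ 0 → v (T i) = v (T j) → i = j := by
    intro i hi j hj hTi hTj hij
    obtain ⟨m, hm⟩ := hpow i hTi
    obtain ⟨m', hm'⟩ := hpow j hTj
    rw [hij, hm'] at hm
    have h : (p : ℤ) * m' - n * j = p * m - n * i := hzpow hm
    have hdvd : (p : ℤ) ∣ n * (j - i) := ⟨m' - m, by linear_combination -h⟩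
    have hdvd' : (p : ℤ) ∣ j - i := (Int.Prime.dvd_mul' hp hdvd).resolve_left
      (by exact_mod_cast hn)
    have := Int.eq_zero_of_abs_lt_dvd hdvd' (by rw [abs_lt]; omega)
    omega
  have hT1 : ∀ i < p, v (T i) ≤ 1 := by
    obtain ⟨j, hj, hmax⟩ := Finset.exists_max_image (Finset.range p) (fun i => v (T i))
      ⟨0, Finset.mem_range.2 hp.pos⟩
    have hj1 : v (T j) ≤ 1 := by
      by_cases hTj : T j = 0
      · simp [hTj]
      · rw [hsum] at hle
        rwa [v.map_sum_eq_of_lt hj] at hle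
        intro i hi
        rw [Finset.mem_sdiff, Finset.mem_singleton] at hi
        refine lt_of_le_of_ne (hmax i hi.1) fun h => hi.2 ?_
        refine hdist i (Finset.mem_range.1 hi.1) j (Finset.mem_range.1 hj) (fun h0 => hTj ?_) hTj h
        rw [h0, map_zero] at h
        exact v.zero_iff.1 h.symm
    exact fun i hi => (hmax i (Finset.mem_range.2 hi)).trans hj1
  refine ⟨by simpa [hT] using hT1 0 hp.pos, ?_⟩
  have hrest : aeval y q - algebraMap k K (q.coeff 0) =
      ∑ i ∈ (Finset.range p).erase 0, T i := by
    rw [hsum, ← Finset.add_sum_erase _ _ (Finset.mem_range.2 hp.pos)]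
    simp [hT]
  rw [hrest]
  refine v.map_sum_lt one_ne_zero fun i hi => ?_
  rw [Finset.mem_erase, Finset.mem_range] at hi
  refine lt_of_le_of_ne (hT1 i hi.2) fun h => ?_
  have hTi : T i ≠ 0 := by
    intro h0
    rw [h0, map_zero] at h
    exact zero_ne_one h
  obtain ⟨m, hm⟩ := hpow i hTi
  rw [h, one_pow, ← zpow_zero π] at hm
  have h0 : (0 : ℤ) = p * m - n * i := hzpow hm
  have hdvd : (p : ℤ) ∣ n * i := ⟨m, by linear_combination h0⟩
  have hdvd' : (p : ℤ) ∣ i := (Int.Prime.dvd_mul' hp hdvd).resolve_left (by exact_mod_cast hn)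
  exact Nat.not_dvd_of_pos_of_lt (Nat.pos_of_ne_zero hi.1) hi.2 (by exact_mod_cast hdvd')

theorem aeval_ne_zero_of_not_dvd {F Ω : Type*} [Field F] [Field Ω] [Algebra F Ω] {P u : F[X]}
    (hP : Irreducible P) {α : Ω} (hPα : aeval α P = 0) (hu : ¬ P ∣ u) : aeval α u ≠ 0 := by
  obtain ⟨r, s, hrs⟩ := (hP.coprime_iff_not_dvd.2 hu : IsCoprime P u)
  intro h0
  have := congrArg (aeval α) hrs
  simp [hPα, h0] at this

variable {F : Type*} [Field F] {p : ℕ} [Fact p.Prime] [CharP F p] {a b : F[X]}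

omit [CharP F p] in
/-- A point `φ` over a pole `α` takes the value `c(α)` at the function `q(y)`, where `c` is the
constant term of `q`: the other terms have positive valuation. -/
theorem algHom_apply_mul_denom [Fact (Irreducible (equation p a b))] {Ω : Type*} [Field Ω]
    [Algebra F Ω] {α : Ω} {P w : F[X]} {n : ℕ} (hP : Irreducible P) (hb : b = P ^ n * w)
    (hPα : aeval α P = 0) (hwα : aeval α w ≠ 0) (haα : aeval α a ≠ 0) (hn : ¬ p ∣ n)
    (φ : CoordinateRing p a b →ₐ[F] Ω) (hφ : φ (algebraMap F[X] _ X) = α)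
    (x : CoordinateRing p a b) {q : (RatFunc F)[X]} (hq : q.natDegree < p)
    (hx : aeval (AdjoinRoot.root (equation p a b)) q = x.1) :
    aeval α (q.coeff 0).denom ≠ 0 ∧
      φ x * aeval α (q.coeff 0).denom = aeval α (q.coeff 0).num := by
  have hn0 : n ≠ 0 := by rintro rfl; exact hn (dvd_zero _)
  have hpp : p.Prime := Fact.out
  have hφa : ∀ r : F[X], φ (algebraMap F[X] _ r) = aeval α r := fun r => by
    rw [algHom_algebraMap, hφ]
  obtain ⟨V, hV⟩ := exists_valuationSubring_of_ringHom
    (K := FunctionField p a b) (O := CoordinateRing p a b) Subtype.val_injective φ.toRingHom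
  set v := V.valuation with hv
  -- A place of the function field above `φ`; on `F[t]` it is the place of `P`.
  have hle : ∀ r : F[X], v (algebraMap F[X] (FunctionField p a b) r) ≤ 1 := fun r =>
    (hV (algebraMap F[X] _ r)).1
  have hlt : ∀ r : F[X], v (algebraMap F[X] (FunctionField p a b) r) < 1 ↔ aeval α r = 0 :=
    fun r => by rw [← hφa r]; exact (hV (algebraMap F[X] _ r)).2
  have hone : ∀ r : F[X], aeval α r ≠ 0 → v (algebraMap F[X] (FunctionField p a b) r) = 1 :=
    fun r hr => le_antisymm (hle r) (not_lt.1 fun h => hr ((hlt r).1 h))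
  set π := v (algebraMap F[X] (FunctionField p a b) P) with hπ
  have hπ1 : π < 1 := (hlt P).2 hPα
  have hπ0 : π ≠ 0 := by
    rw [hπ, v.ne_zero_iff, Ne, map_eq_zero_iff _ algebraMap_functionField_injective]
    exact hP.ne_zero
  have hpoly : ∀ r : F[X], r ≠ 0 →
      ∃ m : ℕ, v (algebraMap F[X] (FunctionField p a b) r) = π ^ m := by
    intro r hr
    obtain ⟨u, hu, hu'⟩ :=
      (FiniteMultiplicity.of_prime_left hP.prime hr).exists_eq_pow_mul_and_not_dvd
    refine ⟨multiplicity P r, ?_⟩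
    conv_lhs => rw [hu]
    rw [map_mul, map_mul, map_pow, map_pow, hone u (aeval_ne_zero_of_not_dvd hP hPα hu'), mul_one]
  have hratdiv : ∀ r s : F[X], v (algebraMap (RatFunc F) (FunctionField p a b)
      (algebraMap F[X] (RatFunc F) r / algebraMap F[X] (RatFunc F) s)) =
      v (algebraMap F[X] (FunctionField p a b) r) /
        v (algebraMap F[X] (FunctionField p a b) s) := by
    intro r s
    rw [map_div₀, map_div₀, ← IsScalarTower.algebraMap_apply, ← IsScalarTower.algebraMap_apply]
  have hrat : ∀ c : RatFunc F, c ≠ 0 → ∃ m : ℤ,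
      v (algebraMap (RatFunc F) (FunctionField p a b) c) = π ^ m := by
    intro c hc
    obtain ⟨i, hi⟩ := hpoly c.num (RatFunc.num_ne_zero hc)
    obtain ⟨j, hj⟩ := hpoly c.denom c.denom_ne_zero
    refine ⟨(i : ℤ) - j, ?_⟩
    rw [← c.num_div_denom, hratdiv, hi, hj, zpow_sub₀ hπ0, zpow_natCast, zpow_natCast]
  set y := AdjoinRoot.root (equation p a b) with hy
  have hbval : v (algebraMap F[X] (FunctionField p a b) b) = π ^ n := by
    refine (congrArg (fun r => v (algebraMap F[X] (FunctionField p a b) r)) hb).trans ?_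
    rw [map_mul, map_mul, hone w hwα, mul_one, map_pow, map_pow]
  have hyval : v (y ^ p - y) * π ^ n = 1 := by
    rw [hy, root_pow_sub_root, hratdiv, hbval, hone a haα, one_div,
      inv_mul_cancel₀ (pow_ne_zero _ hπ0)]
  have hy1 : 1 < v y := by
    by_contra! hle1
    have h1 : v (y ^ p - y) ≤ 1 := by
      refine (v.map_sub _ _).trans (max_le ?_ hle1)
      rw [map_pow]
      exact pow_le_one' hle1 p
    have h2 : π ^ n < 1 := pow_lt_one₀ zero_le hπ1 hn0
    have h3 := mul_lt_one_of_nonneg_of_lt_one_right h1 zero_le h2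
    exact h3.ne hyval
  have hyp : v y ^ p * π ^ n = 1 := by
    have : v (y ^ p - y) = v (y ^ p) := by
      refine v.map_sub_eq_of_lt_left ?_
      rw [map_pow]
      exact lt_self_pow₀ hy1 hpp.one_lt
    rw [← map_pow, ← this, hyval]
  obtain ⟨h1, h2⟩ := valuation_aeval_sub_lt hpp v hπ0 hπ1 hrat hn hyp hq
    (by rw [hx]; exact (hV x).1)
  set c := q.coeff 0 with hc
  have hden : aeval α c.denom ≠ 0 := by
    intro h0
    have hnum : aeval α c.num ≠ 0 := by
      intro h0'
      obtain ⟨r, s, hrs⟩ := c.isCoprime_num_denom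
      have := congrArg (aeval α) hrs
      simp [h0, h0'] at this
    rw [← c.num_div_denom, hratdiv, hone _ hnum, one_div] at h1
    have h3 := (hlt c.denom).2 h0
    have h4 : v (algebraMap F[X] (FunctionField p a b) c.denom) ≠ 0 := by
      rw [v.ne_zero_iff, Ne, map_eq_zero_iff _ algebraMap_functionField_injective]
      exact c.denom_ne_zero
    exact h1.not_gt ((one_lt_inv₀ (zero_lt_iff.2 h4)).2 h3)
  refine ⟨hden, ?_⟩
  have hzero : φ (x * algebraMap F[X] _ c.denom - algebraMap F[X] _ c.num) = 0 := by
    refine (hV _).2.1 ?_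
    change v (x.1 * algebraMap F[X] (FunctionField p a b) c.denom -
      algebraMap F[X] (FunctionField p a b) c.num) < 1
    have hcd : algebraMap F[X] (FunctionField p a b) c.num =
        algebraMap (RatFunc F) (FunctionField p a b) c *
          algebraMap F[X] (FunctionField p a b) c.denom := by
      rw [IsScalarTower.algebraMap_apply F[X] (RatFunc F) (FunctionField p a b),
        IsScalarTower.algebraMap_apply F[X] (RatFunc F) (FunctionField p a b), ← map_mul]
      congr 1
      rw [eq_comm, ← eq_div_iff, c.num_div_denom]
      simpa using c.denom_ne_zero
    rw [hcd, ← sub_mul, map_mul, hone _ hden, mul_one, ← hx]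
    exact h2
  rw [map_sub, map_mul, hφa, hφa] at hzero
  exact sub_eq_zero.1 hzero

omit [CharP F p] in
/-- The fibre over a pole of order prime to `p`, where the cover is totally ramified. -/
theorem natCard_fiber_of_pole [Fact (Irreducible (equation p a b))] {E : Type*} [Field E]
    [Algebra F E] {α : E} {P w : F[X]} {n : ℕ} (hP : Irreducible P) (hb : b = P ^ n * w)
    (hPα : aeval α P = 0) (hwα : aeval α w ≠ 0) (haα : aeval α a ≠ 0) (hn : ¬ p ∣ n) :
    Nat.card {φ : AffinePoints p a b E //
      φ (algebraMap F[X] (CoordinateRing p a b) X) = α} = 1 := by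
  have hrep : ∀ x : CoordinateRing p a b, ∃ q : (RatFunc F)[X], q.natDegree < p ∧
      aeval (AdjoinRoot.root (equation p a b)) q = x.1 := by
    intro x
    obtain ⟨q, hq, hxq⟩ := (AdjoinRoot.powerBasis
      (monic_equation (p := p) (a := a) (b := b)).ne_zero).exists_eq_aeval x.1
    rw [AdjoinRoot.powerBasis_dim, natDegree_equation] at hq
    rw [AdjoinRoot.powerBasis_gen] at hxq
    exact ⟨q, hq, hxq.symm⟩
  rw [Nat.card_eq_one_iff_unique]
  refine ⟨⟨?_⟩, ?_⟩
  · rintro ⟨φ, hφ⟩ ⟨ψ, hψ⟩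
    refine Subtype.ext (AlgHom.ext fun x => ?_)
    obtain ⟨q, hq, hx⟩ := hrep x
    obtain ⟨h0, h1⟩ := algHom_apply_mul_denom hP hb hPα hwα haα hn φ hφ x hq hx
    obtain ⟨-, h2⟩ := algHom_apply_mul_denom hP hb hPα hwα haα hn ψ hψ x hq hx
    exact mul_right_cancel₀ h0 (h1.trans h2.symm)
  -- A point over the algebraic closure takes rational values, by the same formula.
  · let Ω := AlgebraicClosure E
    obtain ⟨φ, hφ⟩ := exists_algHom_algebraMap_X_eq (F := F)
      (algebraMap_coordinateRing_injective (p := p) (a := a) (b := b)) (algebraMap E Ω α)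
    have hev : ∀ r : F[X], aeval (algebraMap E Ω α) r = algebraMap E Ω (aeval α r) :=
      fun r => aeval_algebraMap_apply _ _ _
    have hne : ∀ r : F[X], aeval α r ≠ 0 → aeval (algebraMap E Ω α) r ≠ 0 := fun r hr => by
      rw [hev]; exact (_root_.map_ne_zero _).2 hr
    obtain ⟨ψ, hψ⟩ := exists_algHom_of_forall_mem_range (E := E) φ (by
      intro x
      obtain ⟨q, hq, hx⟩ := hrep x
      obtain ⟨h0, h1⟩ := algHom_apply_mul_denom hP hb (by rw [hev, hPα, map_zero]) (hne _ hwα)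
        (hne _ haα) hn φ hφ x hq hx
      refine ⟨aeval α (q.coeff 0).num / aeval α (q.coeff 0).denom, ?_⟩
      rw [map_div₀, ← hev, ← hev, div_eq_iff h0, h1])
    exact ⟨ψ, (algebraMap E Ω).injective (by rw [hψ, hφ])⟩

end Ramified

/-! ### Binary forms and their zeros -/

section Forms

variable {F : Type*} [Field F]

/-- Dehomogenization `g ↦ g(X, 1)` as a homomorphism of algebras. -/
def dehom (F : Type*) [Field F] : MvPolynomial (Fin 2) F →ₐ[F] F[X] := MvPolynomial.aeval ![X, 1]

theorem aeval_dehom {E : Type*} [CommRing E] [Algebra F E] (α : E) (g : MvPolynomial (Fin 2) F) :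
    aeval α (dehom F g) = MvPolynomial.aeval ![α, 1] g := by
  have : (aeval α).comp (dehom F) = MvPolynomial.aeval ![α, 1] := by
    refine MvPolynomial.algHom_ext fun i => ?_
    fin_cases i <;> simp [dehom]
  exact DFunLike.congr_fun this g

theorem dehom_homogenize {f : F[X]} {n : ℕ} (hf : f.natDegree ≤ n) :
    dehom F (f.homogenize n) = f := aeval_homogenize_X_one f hf

variable {g : MvPolynomial (Fin 2) F} {d : ℕ}

theorem homogenize_dehom (hg : g.IsHomogeneous d) : (dehom F g).homogenize d = g :=
  homogenize_eq_of_isHomogeneous hg rfl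

theorem natDegree_dehom_le (hg : g.IsHomogeneous d) : (dehom F g).natDegree ≤ d := by
  rw [g.as_sum, map_sum]
  refine natDegree_sum_le_of_forall_le _ _ fun m hm => ?_
  have hm' : m.weight 1 = d := hg (by simpa using hm)
  rw [Finsupp.weight_apply, Finsupp.sum_fintype _ _ (by simp), Fin.sum_univ_two] at hm'
  simp only [Pi.one_apply, smul_eq_mul, mul_one] at hm'
  rw [dehom, MvPolynomial.aeval_monomial, Finsupp.prod_fintype _ _ (by simp), Fin.prod_univ_two]
  simp only [Matrix.cons_val_zero, Matrix.cons_val_one, one_pow, mul_one]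
  refine (natDegree_C_mul_X_pow_le _ _).trans ?_
  omega

theorem aeval_infty {E : Type*} [CommRing E] [Algebra F E] (hg : g.IsHomogeneous d) :
    MvPolynomial.aeval ![(1 : E), 0] g = algebraMap F E ((dehom F g).coeff d) := by
  conv_lhs => rw [← homogenize_dehom hg, homogenize, map_sum]
  rw [Finset.sum_eq_single (d, 0)]
  · rw [MvPolynomial.aeval_monomial, Finsupp.prod_fintype _ _ (by simp), Fin.prod_univ_two]
    simp
  · rintro ⟨i, j⟩ hij hne
    have hj : j ≠ 0 := by
      rintro rfl
      rw [Finset.HasAntidiagonal.mem_antidiagonal] at hij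
      exact hne (by simpa using hij)
    rw [MvPolynomial.aeval_monomial, Finsupp.prod_fintype _ _ (by simp), Fin.prod_univ_two]
    simp [hj]
  · intro h
    exact absurd (Finset.HasAntidiagonal.mem_antidiagonal.2 (by simp)) h

theorem natDegree_dehom {E : Type*} [CommRing E] [Algebra F E] (hg : g.IsHomogeneous d)
    (h : MvPolynomial.aeval ![(1 : E), 0] g ≠ 0) : (dehom F g).natDegree = d := by
  refine le_antisymm (natDegree_dehom_le hg) (le_natDegree_of_ne_zero fun h0 => h ?_)
  rw [aeval_infty hg, h0, map_zero]

theorem X_one_dvd_of_aeval_infty {E : Type*} [Field E] [Algebra F E] (hg : g.IsHomogeneous d)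
    (h : MvPolynomial.aeval ![(1 : E), 0] g = 0) : MvPolynomial.X 1 ∣ g := by
  rw [aeval_infty hg, map_eq_zero] at h
  by_cases h0 : dehom F g = 0
  · rw [← homogenize_dehom hg, h0, homogenize_zero]
    exact dvd_zero _
  have hlt : (dehom F g).natDegree < d :=
    lt_of_le_of_ne (natDegree_dehom_le hg) fun heq => h0 (leadingCoeff_eq_zero.1 (by
      rw [leadingCoeff, heq, h]))
  obtain ⟨e, rfl⟩ : ∃ e, d = e + 1 := ⟨d - 1, by omega⟩
  refine ⟨(dehom F g).homogenize e, ?_⟩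
  conv_lhs => rw [← homogenize_dehom hg, ← mul_one (dehom F g)]
  rw [homogenize_mul _ _ (Nat.lt_succ_iff.1 hlt) (by simp : (1 : F[X]).natDegree ≤ 1),
    homogenize_one, pow_one, mul_comm]

theorem irreducible_X_one : Irreducible (MvPolynomial.X 1 : MvPolynomial (Fin 2) F) :=
  (MvPolynomial.X_prime (i := 1)).irreducible

section Irreducible

variable {P : MvPolynomial (Fin 2) F} {r : ℕ} (hP : P.IsHomogeneous r) (hirr : Irreducible P)
include hP hirr

theorem degree_pos_of_irreducible : 0 < r := by
  refine Nat.pos_of_ne_zero ?_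
  rintro rfl
  have hC : P = MvPolynomial.C ((dehom F P).coeff 0) := by
    have h := homogenize_dehom hP
    rw [eq_C_of_natDegree_le_zero (natDegree_dehom_le hP), homogenize_C, pow_zero, mul_one] at h
    exact h.symm
  have h0 : (dehom F P).coeff 0 ≠ 0 := by
    intro h0
    rw [h0, map_zero] at hC
    exact hirr.ne_zero hC
  refine hirr.not_isUnit ?_
  rw [hC]
  exact (isUnit_iff_ne_zero.2 h0).map _

theorem associated_X_one_of_aeval_infty {E : Type*} [Field E] [Algebra F E]
    (h : MvPolynomial.aeval ![(1 : E), 0] P = 0) : Associated (MvPolynomial.X 1) P :=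
  irreducible_X_one.associated_of_dvd hirr (X_one_dvd_of_aeval_infty hP h)

theorem degree_eq_one_of_aeval_infty {E : Type*} [Field E] [Algebra F E]
    (h : MvPolynomial.aeval ![(1 : E), 0] P = 0) : r = 1 := by
  obtain ⟨u, hu⟩ := associated_X_one_of_aeval_infty hP hirr h
  obtain ⟨c, -, hC⟩ := MvPolynomial.isUnit_iff_eq_C_of_isReduced.1 u.isUnit
  have h1 : P.IsHomogeneous (1 + 0) := by
    rw [← hu, hC]
    exact (MvPolynomial.isHomogeneous_X F 1).mul (MvPolynomial.isHomogeneous_C _ _)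
  exact hP.inj_right h1 hirr.ne_zero

theorem irreducible_dehom {E : Type*} [Field E] [Algebra F E]
    (h : MvPolynomial.aeval ![(1 : E), 0] P ≠ 0) : Irreducible (dehom F P) := by
  have hdeg := natDegree_dehom hP h
  have hr := degree_pos_of_irreducible hP hirr
  have h0 : dehom F P ≠ 0 := by
    intro h0
    rw [h0, natDegree_zero] at hdeg
    omega
  refine ⟨fun hu => ?_, fun u s hus => ?_⟩
  · rw [natDegree_eq_zero_of_isUnit hu] at hdeg
    omega
  · rw [hus, mul_ne_zero_iff] at h0
    rw [hus, natDegree_mul h0.1 h0.2] at hdeg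
    have hPus : P = u.homogenize u.natDegree * s.homogenize s.natDegree := by
      rw [← homogenize_mul _ _ le_rfl le_rfl, ← hus, hdeg, homogenize_dehom hP]
    have hunit := (hirr.isUnit_or_isUnit hPus).imp (IsUnit.map (dehom F)) (IsUnit.map (dehom F))
    rwa [dehom_homogenize le_rfl, dehom_homogenize le_rfl] at hunit

omit hirr in
theorem dvd_of_dehom_dvd {E : Type*} [Field E] [Algebra F E]
    (h : MvPolynomial.aeval ![(1 : E), 0] P ≠ 0) (hg : g.IsHomogeneous d)
    (hdvd : dehom F P ∣ dehom F g) : P ∣ g := by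
  obtain ⟨s, hs⟩ := hdvd
  by_cases hg0 : dehom F g = 0
  · rw [← homogenize_dehom hg, hg0, homogenize_zero]
    exact dvd_zero _
  have hdeg := natDegree_dehom hP h
  have hle := natDegree_dehom_le hg
  have hmul := mul_ne_zero_iff.1 (hs ▸ hg0 : dehom F P * s ≠ 0)
  rw [hs, natDegree_mul hmul.1 hmul.2, hdeg] at hle
  refine ⟨s.homogenize (d - r), ?_⟩
  conv_rhs => rw [← homogenize_dehom hP]
  rw [← homogenize_mul _ _ hdeg.le (by omega), ← hs, show r + (d - r) = d by omega,
    homogenize_dehom hg]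

end Irreducible

/-- Homogeneous coordinates of a point of the projective line over `E`; the value at `none` is the
point at infinity. -/
def coords {E : Type*} [Field E] : Option E → Fin 2 → E
  | none => ![1, 0]
  | some α => ![α, 1]

/-- The value of a form at a point of the projective line, in the coordinates `coords`. -/
def evalAt (E : Type*) [Field E] [Algebra F E] (x : Option E) : MvPolynomial (Fin 2) F →ₐ[F] E :=
  MvPolynomial.aeval (coords x)

variable {E : Type*} [Field E] [Algebra F E]

theorem evalAt_none (g : MvPolynomial (Fin 2) F) :
    evalAt E none g = MvPolynomial.aeval ![(1 : E), 0] g := rfl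

theorem evalAt_some (α : E) (g : MvPolynomial (Fin 2) F) :
    evalAt E (some α) g = aeval α (dehom F g) := (aeval_dehom α g).symm

theorem evalAt_none_ne_zero_of_evalAt_some {P : MvPolynomial (Fin 2) F} {r : ℕ}
    (hP : P.IsHomogeneous r) (hirr : Irreducible P) {α : E} (h : evalAt E (some α) P = 0) :
    evalAt E none P ≠ 0 := by
  intro h0
  obtain ⟨u, hu⟩ := associated_X_one_of_aeval_infty hP hirr h0
  have h1 : IsUnit (dehom F P) := by
    rw [← hu, map_mul, show dehom F (MvPolynomial.X 1) = 1 by simp [dehom], one_mul]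
    exact u.isUnit.map _
  rw [evalAt_some] at h
  exact (h1.map (aeval α)).ne_zero h

/-- Two forms with a common zero on the projective line, one of them irreducible. -/
theorem dvd_of_evalAt_eq_zero {P : MvPolynomial (Fin 2) F} {r : ℕ}
    (hP : P.IsHomogeneous r) (hirr : Irreducible P) (hg : g.IsHomogeneous d) {x : Option E}
    (hPx : evalAt E x P = 0) (hgx : evalAt E x g = 0) : P ∣ g := by
  cases x with
  | none =>
    exact (associated_X_one_of_aeval_infty hP hirr hPx).symm.dvd.trans
      (X_one_dvd_of_aeval_infty hg hgx)
  | some α =>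
    have hne := evalAt_none_ne_zero_of_evalAt_some hP hirr hPx
    refine dvd_of_dehom_dvd hP hne hg ?_
    by_contra hd
    rw [evalAt_some] at hPx hgx
    exact aeval_ne_zero_of_not_dvd (irreducible_dehom hP hirr hne) hPx hd hgx

end Forms

/-! ### Factorizations of forms -/

/-- The form `h` is, up to a nonzero constant, the product of the `P i ^ d i` for pairwise
non-proportional irreducible forms `P i` of degree `r i`. -/
structure IsFactorization {F : Type*} [Field F] {ι : Type*} [Fintype ι]
    (P : ι → MvPolynomial (Fin 2) F) (r d : ι → ℕ) (h : MvPolynomial (Fin 2) F) : Prop where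
  isHomogeneous : ∀ i, (P i).IsHomogeneous (r i)
  irreducible : ∀ i, Irreducible (P i)
  eq_of_associated : ∀ i j, Associated (P i) (P j) → i = j
  associated : Associated h (∏ i, P i ^ d i)

namespace IsFactorization

variable {F : Type*} [Field F] {ι : Type*} [Fintype ι]
  {P : ι → MvPolynomial (Fin 2) F} {r d : ι → ℕ} {h : MvPolynomial (Fin 2) F}
  (H : IsFactorization P r d h)
  {E : Type*} [Field E] [Algebra F E]
include H

theorem eq_of_dvd {i j : ι} (hij : P i ∣ P j) : i = j :=
  H.eq_of_associated i j ((H.irreducible i).associated_of_dvd (H.irreducible j) hij)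

theorem exists_eq_pow_mul [DecidableEq ι] (i : ι) : ∃ u : (MvPolynomial (Fin 2) F)ˣ,
    h = P i ^ d i * (u * ∏ j ∈ Finset.univ.erase i, P j ^ d j) := by
  obtain ⟨u, hu⟩ := H.associated
  refine ⟨u⁻¹, ?_⟩
  rw [← Finset.mul_prod_erase _ _ (Finset.mem_univ i)] at hu
  rw [mul_left_comm, ← hu, mul_comm h, ← mul_assoc, Units.inv_mul, one_mul]

theorem evalAt_eq_zero_iff (hd : ∀ i, d i ≠ 0) {x : Option E} :
    evalAt E x h = 0 ↔ ∃ i, evalAt E x (P i) = 0 := by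
  have := (H.associated.map (evalAt E x)).eq_zero_iff
  rw [this, map_prod, Finset.prod_eq_zero_iff]
  simp [hd]

theorem eq_of_evalAt_eq_zero {x : Option E} {i j : ι} (hi : evalAt E x (P i) = 0)
    (hj : evalAt E x (P j) = 0) : i = j :=
  H.eq_of_dvd
    (dvd_of_evalAt_eq_zero (H.isHomogeneous i) (H.irreducible i) (H.isHomogeneous j) hi hj)

theorem dvd (hd : ∀ i, d i ≠ 0) (i : ι) : P i ∣ h := by
  classical
  refine Dvd.dvd.trans ?_ H.associated.symm.dvd
  exact (dvd_pow_self _ (hd i)).trans (Finset.dvd_prod_of_mem _ (Finset.mem_univ i))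

theorem isRelPrime_iff (hd : ∀ i, d i ≠ 0) {g : MvPolynomial (Fin 2) F} :
    IsRelPrime g h ↔ ∀ i, ¬ P i ∣ g := by
  constructor
  · intro hrel i hi
    exact (H.irreducible i).not_isUnit (hrel hi (H.dvd hd i))
  · intro hP
    have h1 : IsRelPrime g (∏ i, P i ^ d i) :=
      IsRelPrime.prod_right fun i _ => IsRelPrime.pow_right
        ((H.irreducible i).isRelPrime_iff_not_dvd.2 (hP i)).symm
    exact h1.of_dvd_right H.associated.dvd

variable {n : ℕ} {g : MvPolynomial (Fin 2) F} {p : ℕ}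

/-- A zero of `h` in `E` lies on exactly one factor `P i`, which is a pole of order `d i`. -/
theorem exists_pole (hd : ∀ i, d i ≠ 0) (hdp : ∀ i, ¬ p ∣ d i) (hg : g.IsHomogeneous n)
    (hgh : IsRelPrime g h) {α : E} (hα : aeval α (dehom F h) = 0) :
    ∃ (Q w : F[X]) (m : ℕ), Irreducible Q ∧ dehom F h = Q ^ m * w ∧ aeval α Q = 0 ∧
      aeval α w ≠ 0 ∧ aeval α (dehom F g) ≠ 0 ∧ ¬ p ∣ m := by
  classical
  rw [← evalAt_some, H.evalAt_eq_zero_iff hd] at hα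
  obtain ⟨i, hi⟩ := hα
  obtain ⟨u, hu⟩ := H.exists_eq_pow_mul i
  refine ⟨dehom F (P i), dehom F (u * ∏ j ∈ Finset.univ.erase i, P j ^ d j), d i,
    irreducible_dehom (H.isHomogeneous i) (H.irreducible i)
      (evalAt_none_ne_zero_of_evalAt_some (H.isHomogeneous i) (H.irreducible i) hi), ?_, ?_, ?_, ?_,
    hdp i⟩
  · rw [← map_pow, ← map_mul, ← hu]
  · rwa [← evalAt_some]
  · rw [← evalAt_some, map_mul, map_prod]
    refine mul_ne_zero (u.isUnit.map _).ne_zero (Finset.prod_ne_zero_iff.2 fun j hj => ?_)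
    rw [map_pow]
    exact pow_ne_zero _ fun h0 => Finset.ne_of_mem_erase hj (H.eq_of_evalAt_eq_zero h0 hi)
  · rw [← evalAt_some]
    intro h0
    exact (H.isRelPrime_iff hd).1 hgh i
      (dvd_of_evalAt_eq_zero (H.isHomogeneous i) (H.irreducible i) hg hi h0)

/-- A pole of order prime to `p` makes the equation irreducible. If the chosen factor of `h` is
proportional to the second variable, the pole is at infinity and shows in the degrees only. -/
theorem irreducible_equation [Nonempty ι] [Fact p.Prime] [CharP F p] (hd : ∀ i, d i ≠ 0)
    (hdp : ∀ i, ¬ p ∣ d i) (hn : n = ∑ i, r i * d i) (hg : g.IsHomogeneous n)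
    (hgh : IsRelPrime g h) : Irreducible (equation p (dehom F g) (dehom F h)) := by
  classical
  obtain ⟨i⟩ := ‹Nonempty ι›
  have hgP := (H.isRelPrime_iff hd).1 hgh
  obtain ⟨u, hu⟩ := H.exists_eq_pow_mul i
  by_cases hi : evalAt F none (P i) = 0
  · obtain ⟨u', hu'⟩ := associated_X_one_of_aeval_infty (H.isHomogeneous i) (H.irreducible i) hi
    have hr : r i = 1 := degree_eq_one_of_aeval_infty (H.isHomogeneous i) (H.irreducible i) hi
    set w := ∏ j ∈ Finset.univ.erase i, P j ^ d j with hw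
    have hwhom : w.IsHomogeneous (∑ j ∈ Finset.univ.erase i, r j * d j) :=
      MvPolynomial.IsHomogeneous.prod _ _ _ fun j _ => (H.isHomogeneous j).pow _
    have hwinf : evalAt F none w ≠ 0 := by
      rw [hw, map_prod]
      refine Finset.prod_ne_zero_iff.2 fun j hj => ?_
      rw [map_pow]
      exact pow_ne_zero _ fun h0 => Finset.ne_of_mem_erase hj (H.eq_of_evalAt_eq_zero h0 hi)
    have hwdeg := natDegree_dehom (E := F) hwhom hwinf
    have hgdeg := natDegree_dehom (E := F) hg (fun h0 => hgP i
      (dvd_of_evalAt_eq_zero (H.isHomogeneous i) (H.irreducible i) hg (x := none) hi h0))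
    have hunit : IsUnit (dehom F (P i)) := by
      rw [← hu', map_mul, show dehom F (MvPolynomial.X 1) = 1 by simp [dehom], one_mul]
      exact u'.isUnit.map _
    have hunit' : IsUnit (dehom F (P i) ^ d i * dehom F u) :=
      (hunit.pow _).mul (u.isUnit.map _)
    have hh : dehom F h = (dehom F (P i) ^ d i * dehom F u) * dehom F w := by
      rw [hu, map_mul, map_mul, map_pow, mul_assoc]
    have hw0 : dehom F w ≠ 0 := by
      intro h0
      rw [← homogenize_dehom hwhom, h0, homogenize_zero, map_zero] at hwinf
      exact hwinf rfl
    have hhdeg : (dehom F h).natDegree = ∑ j ∈ Finset.univ.erase i, r j * d j := by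
      rw [hh, natDegree_mul hunit'.ne_zero hw0, natDegree_eq_zero_of_isUnit hunit', zero_add, hwdeg]
    refine irreducible_equation_of_degree (n := d i) (hh ▸ mul_ne_zero hunit'.ne_zero hw0) ?_
      (hdp i)
    rw [hgdeg, hhdeg, hn, ← Finset.add_sum_erase _ _ (Finset.mem_univ i), hr, one_mul, add_comm]
  · refine irreducible_equation_of_pole (P := dehom F (P i)) (n := d i)
      (w := dehom F (u * ∏ j ∈ Finset.univ.erase i, P j ^ d j))
      (irreducible_dehom (H.isHomogeneous i) (H.irreducible i) hi).prime ?_ ?_ ?_ (hdp i)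
    · rw [← map_pow, ← map_mul, ← hu]
    · have hpr := (irreducible_dehom (H.isHomogeneous i) (H.irreducible i) hi).prime
      intro hdvd
      rw [map_mul, (u.isUnit.map (dehom F)).dvd_mul_left, map_prod, hpr.dvd_finsetProd_iff] at hdvd
      obtain ⟨j, hj, hdvd⟩ := hdvd
      rw [map_pow] at hdvd
      exact Finset.ne_of_mem_erase hj (H.eq_of_dvd (dvd_of_dehom_dvd
        (H.isHomogeneous i) hi (H.isHomogeneous j) (hpr.dvd_of_dvd_pow hdvd))).symm
    · exact fun hdvd => hgP i
        (dvd_of_dehom_dvd (H.isHomogeneous i) hi hg hdvd)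

end IsFactorization

/-! ### The number of points as a sum over the projective line -/

section NumPoints

/-- The number of points of `y ^ p - y = u / w` over a point of the projective line at which the
two forms of the equation take the values `u` and `w`. -/
def fiberCount (p : ℕ) {E : Type*} [Field E] (u w : E) : ℕ :=
  open Classical in if w = 0 then 1 else Nat.card {y : E // y ^ p - y = u / w}

variable {F : Type*} [Field F] {p : ℕ} [Fact p.Prime] [CharP F p] {a b : F[X]}
  {E : Type*} [Field E] [Algebra F E]

theorem finite_fiber_and_natCard_fiber [Finite E] [Fact (Irreducible (equation p a b))] {α : E}
    (hpole : aeval α b = 0 → ∃ (Q w : F[X]) (m : ℕ), Irreducible Q ∧ b = Q ^ m * w ∧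
      aeval α Q = 0 ∧ aeval α w ≠ 0 ∧ aeval α a ≠ 0 ∧ ¬ p ∣ m) :
    Finite {φ : AffinePoints p a b E // φ (algebraMap F[X] (CoordinateRing p a b) X) = α} ∧
      Nat.card {φ : AffinePoints p a b E // φ (algebraMap F[X] (CoordinateRing p a b) X) = α} =
        fiberCount p (aeval α a) (aeval α b) := by
  by_cases hb : aeval α b = 0
  · obtain ⟨Q, w, m, hQ, hbQ, hQα, hwα, haα, hm⟩ := hpole hb
    have h := natCard_fiber_of_pole hQ hbQ hQα hwα haα hm
    refine ⟨Nat.finite_of_card_ne_zero (h ▸ one_ne_zero), ?_⟩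
    rw [h, fiberCount, if_pos hb]
  · obtain ⟨e⟩ := nonempty_fiber_equiv (p := p) (a := a) hb
    refine ⟨Finite.of_equiv _ e.symm, ?_⟩
    rw [Nat.card_congr e, fiberCount, if_neg hb]

theorem natCard_affinePoints [Fintype E] [Fact (Irreducible (equation p a b))]
    (hpole : ∀ α : E, aeval α b = 0 → ∃ (Q w : F[X]) (m : ℕ), Irreducible Q ∧ b = Q ^ m * w ∧
      aeval α Q = 0 ∧ aeval α w ≠ 0 ∧ aeval α a ≠ 0 ∧ ¬ p ∣ m) :
    Nat.card (AffinePoints p a b E) = ∑ α : E, fiberCount p (aeval α a) (aeval α b) := by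
  have hfin := fun α => (finite_fiber_and_natCard_fiber (hpole α)).1
  rw [← Nat.card_congr (Equiv.sigmaFiberEquiv fun φ : AffinePoints p a b E =>
    φ (algebraMap F[X] (CoordinateRing p a b) X)), Nat.card_sigma]
  exact Finset.sum_congr rfl fun α _ => (finite_fiber_and_natCard_fiber (hpole α)).2

/-- The exchange of the two variables. -/
def swapForm (F : Type*) [Field F] : MvPolynomial (Fin 2) F ≃ₐ[F] MvPolynomial (Fin 2) F :=
  MvPolynomial.renameEquiv F (Equiv.swap 0 1)

theorem dehomogenizeX_eq (g : MvPolynomial (Fin 2) F) :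
    dehomogenizeX g = dehom F (swapForm F g) := by
  rw [dehomogenizeX, dehom, swapForm, MvPolynomial.renameEquiv_apply, MvPolynomial.aeval_rename]
  congr 1
  refine congrArg _ (funext fun i => ?_)
  fin_cases i <;> simp

theorem evalAt_zero_swapForm (g : MvPolynomial (Fin 2) F) :
    evalAt E (some 0) (swapForm F g) = evalAt E none g := by
  rw [evalAt, evalAt, swapForm, MvPolynomial.renameEquiv_apply, MvPolynomial.aeval_rename]
  congr 1
  refine congrArg _ (funext fun i => ?_)
  fin_cases i <;> simp [coords]

theorem isHomogeneous_swapForm {g : MvPolynomial (Fin 2) F} {n : ℕ} (hg : g.IsHomogeneous n) :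
    (swapForm F g).IsHomogeneous n :=
  hg.rename_isHomogeneous

theorem isRelPrime_swapForm {g h : MvPolynomial (Fin 2) F} (hgh : IsRelPrime g h) :
    IsRelPrime (swapForm F g) (swapForm F h) := by
  intro z hg hh
  have h1 : ∀ f, z ∣ swapForm F f → (swapForm F).symm z ∣ f := fun f hf => by
    simpa using map_dvd (swapForm F).symm hf
  exact (MulEquiv.isUnit_map (swapForm F).symm).1 (hgh (h1 g hg) (h1 h hh))

namespace IsFactorization

variable {ι : Type*} [Fintype ι] {P : ι → MvPolynomial (Fin 2) F} {r d : ι → ℕ}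
  {h : MvPolynomial (Fin 2) F}

omit [Fact p.Prime] [CharP F p] in
theorem map_swapForm (H : IsFactorization P r d h) :
    IsFactorization (fun i => swapForm F (P i)) r d (swapForm F h) where
  isHomogeneous i := isHomogeneous_swapForm (H.isHomogeneous i)
  irreducible i := (MulEquiv.irreducible_iff (swapForm F)).2 (H.irreducible i)
  eq_of_associated i j hij := H.eq_of_associated i j (by
    simpa using hij.map (swapForm F).symm)
  associated := by simpa using H.associated.map (swapForm F)

theorem numPoints_eq [Fintype E] [Nonempty ι] (H : IsFactorization P r d h) (hd : ∀ i, d i ≠ 0)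
    (hdp : ∀ i, ¬ p ∣ d i) {g : MvPolynomial (Fin 2) F} {n : ℕ} (hn : n = ∑ i, r i * d i)
    (hg : g.IsHomogeneous n) (hgh : IsRelPrime g h) :
    numPoints p g h E = ∑ x : Option E, fiberCount p (evalAt E x g) (evalAt E x h) := by
  have hirr : Fact (Irreducible (equation p (dehomogenizeZ g) (dehomogenizeZ h))) :=
    ⟨H.irreducible_equation hd hdp hn hg hgh⟩
  have hirr' : Fact (Irreducible (equation p (dehomogenizeX g) (dehomogenizeX h))) := by
    rw [dehomogenizeX_eq, dehomogenizeX_eq]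
    exact ⟨H.map_swapForm.irreducible_equation hd hdp hn (isHomogeneous_swapForm hg)
      (isRelPrime_swapForm hgh)⟩
  have h1 := natCard_affinePoints (p := p) (a := dehomogenizeZ g) (b := dehomogenizeZ h) (E := E)
    fun α => H.exists_pole hd hdp hg hgh
  have h2 := (finite_fiber_and_natCard_fiber (p := p) (a := dehomogenizeX g)
    (b := dehomogenizeX h) (E := E) (α := 0) (by
      rw [dehomogenizeX_eq, dehomogenizeX_eq]
      exact fun hα => H.map_swapForm.exists_pole hd hdp
        (isHomogeneous_swapForm hg) (isRelPrime_swapForm hgh) hα)).2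
  rw [numPoints, h1, h2, Fintype.sum_option, add_comm, dehomogenizeX_eq, dehomogenizeX_eq,
    ← evalAt_some, ← evalAt_some, evalAt_zero_swapForm, evalAt_zero_swapForm]
  simp_rw [evalAt_some]
  rfl

end IsFactorization
end NumPoints

/-! ### Points with small residue field -/

open IntermediateField

section TraceFree

variable {F : Type*} [Field F] {E : Type*} [Field E] [Algebra F E]

/-- The residue field of the point `x` of the projective line over `F` is so small in `E` that the
trace of `E` to the prime field vanishes on it. The coordinate `0` stands in for the point at
infinity, which is rational as well. -/
def IsTraceFree (F : Type*) [Field F] {E : Type*} [Field E] [Algebra F E] (p : ℕ)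
    (x : Option E) : Prop := p ∣ Module.finrank F⟮x.getD 0⟯ E

variable {p : ℕ}

theorem isTraceFree_iff [Finite E] {x : Option E} :
    IsTraceFree F p x ↔ p * (minpoly F (x.getD 0)).natDegree ∣ Module.finrank F E := by
  have hint : IsIntegral F (x.getD 0) := Algebra.IsIntegral.isIntegral _
  rw [IsTraceFree, ← Module.finrank_mul_finrank F F⟮x.getD 0⟯ E, adjoin.finrank hint, mul_comm p]
  exact (Nat.mul_dvd_mul_iff_left (minpoly.natDegree_pos hint)).symm

theorem isTraceFree_none [Finite E] :
    IsTraceFree F p (none : Option E) ↔ p ∣ Module.finrank F E := by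
  rw [isTraceFree_iff]
  simp

theorem evalAt_mem_adjoin (x : Option E) {n : ℕ} {g : MvPolynomial (Fin 2) F}
    (hg : g.IsHomogeneous n) : evalAt E x g ∈ F⟮x.getD 0⟯ := by
  cases x with
  | none =>
    rw [evalAt_none, aeval_infty hg]
    exact IntermediateField.algebraMap_mem _ _
  | some α =>
    rw [evalAt_some]
    exact algebra_adjoin_le_adjoin F _ (aeval_mem_adjoin_singleton F α)

variable [Fact p.Prime] [CharP F p] [Finite F] [Fintype E]

/-- The number of elements of `E` in the subfield of degree `m`. -/
theorem card_filter_natDegree_minpoly_dvd {m : ℕ} (hm : 0 < m) (hmk : m ∣ Module.finrank F E) :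
    open Classical in (Finset.univ.filter fun α : E => (minpoly F α).natDegree ∣ m).card =
      Nat.card F ^ m := by
  classical
  obtain ⟨p, hp⟩ := CharP.exists F
  have : Fact p.Prime := ⟨CharP.char_is_prime F p⟩
  have : NeZero m := ⟨hm.ne'⟩
  set L := FiniteField.Extension F p m with hL
  have hLrank : Module.finrank F L = m := FiniteField.finrank_extension F p m
  have hLcard : Nat.card L = Nat.card F ^ m := FiniteField.natCard_extension F p m
  obtain ⟨f⟩ := FiniteField.nonempty_algHom_of_finrank_dvd (F := F) (K := L) (L := E)
    (by rwa [hLrank])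
  refine le_antisymm ?_ ?_
  · have hF : 1 < Nat.card F := Finite.one_lt_card
    have hne : (X ^ Nat.card F ^ m - X : E[X]) ≠ 0 :=
      FiniteField.X_pow_card_pow_sub_X_ne_zero _ hm.ne' hF
    have hdeg := FiniteField.X_pow_card_pow_sub_X_natDegree_eq E hm.ne' hF
    rw [← hdeg]
    refine le_trans (Finset.card_le_card ?_) ((Multiset.toFinset_card_le _).trans (card_roots' _))
    intro α hα
    rw [Finset.mem_filter] at hα
    rw [Multiset.mem_toFinset, mem_roots hne, IsRoot.def]
    have h1 := ((minpoly.irreducible (Algebra.IsIntegral.isIntegral (R := F) α))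
      ).natDegree_dvd_iff_dvd_X_pow_card_pow_sub_X.1 hα.2
    obtain ⟨s, hs⟩ := h1
    have h2 := congrArg (aeval α) hs
    rw [map_mul, minpoly.aeval, zero_mul] at h2
    simpa using h2
  · have : Finite L := Finite.of_injective f f.toRingHom.injective
    have := Fintype.ofFinite L
    rw [← hLcard, Nat.card_eq_fintype_card, ← Finset.card_univ]
    refine Finset.card_le_card_of_injOn f ?_ f.toRingHom.injective.injOn
    intro y _
    rw [Finset.mem_coe, Finset.mem_filter]
    refine ⟨Finset.mem_univ _, ?_⟩
    rw [minpoly.algHom_eq f f.toRingHom.injective]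
    have h := minpoly.degree_dvd (Algebra.IsIntegral.isIntegral (R := F) y)
    rwa [hLrank] at h

omit [CharP F p] in
theorem card_filter_isTraceFree (hpk : p ∣ Module.finrank F E) :
    open Classical in (Finset.univ.filter fun x : Option E => IsTraceFree F p x).card =
      Nat.card F ^ (Module.finrank F E / p) + 1 := by
  classical
  have hp : 0 < p := (Fact.out : p.Prime).pos
  have hk : 0 < Module.finrank F E := Module.finrank_pos
  obtain ⟨m, hm⟩ := hpk
  have hm0 : 0 < m := Nat.pos_of_ne_zero (by rintro rfl; omega)
  rw [Finset.card_filter, Fintype.sum_option, if_pos (isTraceFree_none.2 ⟨m, hm⟩), add_comm,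
    ← Finset.card_filter]
  simp_rw [isTraceFree_iff, Option.getD_some, hm, Nat.mul_div_cancel_left _ hp,
    Nat.mul_dvd_mul_iff_left hp]
  rw [card_filter_natDegree_minpoly_dvd hm0 (hm ▸ dvd_mul_left m p)]

omit [Fact p.Prime] [CharP F p] [Finite F] in
theorem card_filter_aeval_eq_zero {Q : F[X]} (hQ : Irreducible Q) :
    open Classical in (Finset.univ.filter fun α : E => aeval α Q = 0 ∧
      IsTraceFree F p (some α)).card =
      if p * Q.natDegree ∣ Module.finrank F E then Q.natDegree else 0 := by
  classical
  have hdeg : ∀ α : E, aeval α Q = 0 → (minpoly F α).natDegree = Q.natDegree := by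
    intro α hα
    rw [← minpoly.eq_of_irreducible hQ hα, natDegree_mul_C]
    exact inv_ne_zero (leadingCoeff_ne_zero.2 hQ.ne_zero)
  split_ifs with h
  · have hfilter : (Finset.univ.filter fun α : E => aeval α Q = 0 ∧ IsTraceFree F p (some α)) =
        Finset.univ.filter fun α : E => α ∈ Q.aroots E := by
      refine Finset.filter_congr fun α _ => ?_
      rw [mem_aroots, isTraceFree_iff, Option.getD_some]
      constructor
      · exact fun hα => ⟨hQ.ne_zero, hα.1⟩
      · exact fun hα => ⟨hα.2, by rwa [hdeg α hα.2]⟩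
    have := Fact.mk hQ
    have hrank : Module.finrank F (AdjoinRoot Q) = Q.natDegree :=
      finrank_quotient_span_eq_natDegree
    have hcard := FiniteField.natCard_algHom_of_finrank_dvd (F := F) (K := AdjoinRoot Q) (L := E)
      (hrank ▸ (Dvd.intro_left p rfl).trans h)
    rw [Nat.card_congr (AdjoinRoot.equiv E F Q hQ.ne_zero), hrank, Nat.card_eq_fintype_card,
      Fintype.card_subtype] at hcard
    rw [hfilter, hcard]
  · rw [Finset.card_eq_zero, Finset.filter_eq_empty_iff]
    rintro α - ⟨hα, hfree⟩
    rw [isTraceFree_iff, Option.getD_some, hdeg α hα] at hfree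
    exact h hfree

omit [Fact p.Prime] [CharP F p] [Finite F] in
theorem card_filter_evalAt_eq_zero {P : MvPolynomial (Fin 2) F} {r : ℕ} (hP : P.IsHomogeneous r)
    (hirr : Irreducible P) :
    open Classical in (Finset.univ.filter fun x : Option E => evalAt E x P = 0 ∧
      IsTraceFree F p x).card = if p * r ∣ Module.finrank F E then r else 0 := by
  classical
  rw [Finset.card_filter, Fintype.sum_option, ← Finset.card_filter]
  by_cases h : evalAt E none P = 0
  · have hr := degree_eq_one_of_aeval_infty hP hirr h
    subst hr
    have h0 : (Finset.univ.filter fun α : E => evalAt E (some α) P = 0 ∧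
        IsTraceFree F p (some α)) = ∅ := by
      rw [Finset.filter_eq_empty_iff]
      exact fun α _ hα => evalAt_none_ne_zero_of_evalAt_some hP hirr hα.1 h
    simp [h0, h, isTraceFree_none]
  · simp_rw [evalAt_some]
    rw [if_neg fun h' => h h'.1, zero_add, card_filter_aeval_eq_zero (irreducible_dehom hP hirr h),
      natDegree_dehom hP h]

end TraceFree

/-! ### Sums over the numerators -/

open IntermediateField

section Sums

variable {F : Type*} [Field F] {p : ℕ} [Fact p.Prime] [CharP F p] [Finite F]
  {E : Type*} [Field E] [Algebra F E] [Fintype E]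

omit [CharP F p] [Finite F] in
theorem sum_fiberCount_of_translation [Algebra (ZMod p) E] {h : MvPolynomial (Fin 2) F}
    {x : Option E} (hx : evalAt E x h ≠ 0) (G : Finset (MvPolynomial (Fin 2) F))
    (τ : MvPolynomial (Fin 2) F) (hτ : ∀ g ∈ G, g + τ ∈ G)
    (htr : Algebra.trace (ZMod p) E (evalAt E x τ / evalAt E x h) ≠ 0) :
    ∑ g ∈ G, fiberCount p (evalAt E x g) (evalAt E x h) = G.card := by
  simp_rw [fiberCount, if_neg hx]
  let ev : MvPolynomial (Fin 2) F →+ E :=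
    { toFun := fun g => evalAt E x g / evalAt E x h
      map_zero' := by rw [map_zero, zero_div]
      map_add' := fun g g' => by rw [map_add, add_div] }
  exact sum_natCard_wp_of_translation G ev τ hτ htr

omit [CharP F p] [Finite F] in
theorem fiberCount_of_isTraceFree [Algebra (ZMod p) F] [Algebra (ZMod p) E]
    {g h : MvPolynomial (Fin 2) F} {n : ℕ}
    (hg : g.IsHomogeneous n) (hh : h.IsHomogeneous n) {x : Option E} (hx : evalAt E x h ≠ 0)
    (hfree : IsTraceFree F p x) : fiberCount p (evalAt E x g) (evalAt E x h) = p := by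
  let m : F⟮x.getD 0⟯ :=
    ⟨evalAt E x g, evalAt_mem_adjoin x hg⟩ / ⟨evalAt E x h, evalAt_mem_adjoin x hh⟩
  rw [fiberCount, if_neg hx, natCard_wp_eq, if_pos]
  exact trace_algebraMap_eq_zero hfree m

namespace IsFactorization

variable {ι : Type*} [Fintype ι] {P : ι → MvPolynomial (Fin 2) F} {r d : ι → ℕ}
  {h : MvPolynomial (Fin 2) F} {n : ℕ}

omit [Fact p.Prime] [CharP F p] [Finite F] in
theorem isHomogeneous_of_eq (H : IsFactorization P r d h) (hn : n = ∑ i, r i * d i) :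
    h.IsHomogeneous n := by
  obtain ⟨u, hu⟩ := H.associated.symm
  obtain ⟨c, -, hc⟩ := MvPolynomial.isUnit_iff_eq_C_of_isReduced.1 u.isUnit
  have hprod : (∏ i, P i ^ d i).IsHomogeneous (∑ i, r i * d i) :=
    MvPolynomial.IsHomogeneous.prod _ _ _ fun i _ => (H.isHomogeneous i).pow _
  rw [← hu, hc, hn]
  simpa using hprod.mul (MvPolynomial.isHomogeneous_C _ c)

omit [Fact p.Prime] [CharP F p] [Finite F] in
theorem isRelPrime_add (H : IsFactorization P r d h) (hd : ∀ i, d i ≠ 0)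
    {g τ : MvPolynomial (Fin 2) F} (hτ : ∀ i, P i ∣ τ) (hg : IsRelPrime g h) :
    IsRelPrime (g + τ) h := by
  rw [H.isRelPrime_iff hd] at hg ⊢
  exact fun i hi => hg i ((dvd_add_left (hτ i)).1 hi)

omit [CharP F p] [Finite F] in
/-- A translation of the numerators that equidistributes the traces of their values at a point. -/
theorem exists_translation [Algebra (ZMod p) F] [Algebra (ZMod p) E]
    (H : IsFactorization P r d h) (hd : ∀ i, d i ≠ 0) (hn : n = ∑ i, r i * d i)
    (hk : p ∣ Module.finrank F E → Module.finrank F E + ∑ i, r i ≤ n + 1) {x : Option E}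
    (hx : evalAt E x h ≠ 0) (hfree : ¬ IsTraceFree F p x) :
    ∃ τ : MvPolynomial (Fin 2) F, τ.IsHomogeneous n ∧ (∀ i, P i ∣ τ) ∧
      Algebra.trace (ZMod p) E (evalAt E x τ / evalAt E x h) ≠ 0 := by
  have hh := H.isHomogeneous_of_eq hn
  by_cases hpk : p ∣ Module.finrank F E
  · cases x with
    | none => exact absurd (isTraceFree_none.2 hpk) hfree
    | some α =>
      set M := F⟮α⟯ with hM
      obtain ⟨m, hm⟩ := exists_trace_algebraMap_ne_zero (p := p) (M := M) (E := E) hfree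
      have hint : IsIntegral F α := Algebra.IsIntegral.isIntegral α
      set R := ∏ i, P i with hR
      have hRhom : R.IsHomogeneous (∑ i, r i) :=
        MvPolynomial.IsHomogeneous.prod _ _ _ fun i _ => H.isHomogeneous i
      have hR0 : evalAt E (some α) R ≠ 0 := by
        rw [hR, map_prod, Finset.prod_ne_zero_iff]
        exact fun i _ h0 => hx ((H.evalAt_eq_zero_iff hd).2 ⟨i, h0⟩)
      -- The multiplier of the radical `R` that makes the quotient by `h` equal to `m` at `α`.
      -- It is a polynomial in `α` of degree less than `[F(α) : F]`, which the degree condition admits.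
      let z : M := m * ⟨_, evalAt_mem_adjoin (some α) hh⟩ / ⟨_, evalAt_mem_adjoin (some α) hRhom⟩
      obtain ⟨s, hsdeg, hs⟩ := (adjoin.powerBasis hint).exists_eq_aeval z
      rw [adjoin.powerBasis_dim] at hsdeg
      have hsα : aeval α s = (m : E) * evalAt E (some α) h / evalAt E (some α) R := by
        have h1 := congrArg (algebraMap M E) hs
        rw [adjoin.powerBasis_gen, ← aeval_algebraMap_apply, AdjoinSimple.algebraMap_gen] at h1
        exact h1.symm
      have hle : (minpoly F α).natDegree ≤ Module.finrank F E := minpoly.natDegree_le α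
      have hkn := hk hpk
      have hsdeg' : s.natDegree ≤ n - ∑ i, r i := by omega
      have hkpos : 0 < Module.finrank F E := Module.finrank_pos
      refine ⟨R * s.homogenize (n - ∑ i, r i), ?_, fun i => ?_, ?_⟩
      · have := hRhom.mul (isHomogeneous_homogenize (n := n - ∑ i, r i) s)
        rwa [show ∑ i, r i + (n - ∑ i, r i) = n by omega] at this
      · exact (Finset.dvd_prod_of_mem _ (Finset.mem_univ i)).mul_right _
      · have : evalAt E (some α) (R * s.homogenize (n - ∑ i, r i)) / evalAt E (some α) h =
            algebraMap M E m := by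
          rw [map_mul, evalAt_some α (s.homogenize _), dehom_homogenize hsdeg', hsα,
            mul_div_cancel₀ _ hR0, mul_div_cancel_right₀ _ hx]
          rfl
        rwa [this]
  · obtain ⟨c, hc⟩ := exists_trace_algebraMap_ne_zero (p := p) (M := F) (E := E) hpk
    refine ⟨MvPolynomial.C c * h, ?_, fun i => (H.dvd hd i).mul_left _, ?_⟩
    · simpa using (MvPolynomial.isHomogeneous_C (Fin 2) c).mul hh
    · have : evalAt E x (MvPolynomial.C c * h) / evalAt E x h = algebraMap F E c := by
        rw [map_mul, mul_div_cancel_right₀ _ hx]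
        exact (evalAt E x : _ →ₐ[F] E).commutes c
      rwa [this]

omit [Finite F] in
/-- At a zero of `h` every numerator contributes `1`; elsewhere the residue field decides. -/
theorem sum_numPoints_eq_card_mul [Nonempty ι] (H : IsFactorization P r d h) (hd : ∀ i, d i ≠ 0)
    (hdp : ∀ i, ¬ p ∣ d i) (hn : n = ∑ i, r i * d i)
    (hk : p ∣ Module.finrank F E → Module.finrank F E + ∑ i, r i ≤ n + 1)
    (G : Finset (MvPolynomial (Fin 2) F))
    (hG : ∀ g, g ∈ G ↔ g.IsHomogeneous n ∧ IsRelPrime g h) :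
    open Classical in ∑ g ∈ G, numPoints p g h E = G.card * ∑ x : Option E,
      if evalAt E x h ≠ 0 ∧ IsTraceFree F p x then p else 1 := by
  classical
  let _ := ZMod.algebra F p
  have hchar : CharP E p := charP_of_injective_algebraMap (algebraMap F E).injective p
  let _ := ZMod.algebra E p
  rw [Finset.sum_congr rfl fun g hg =>
    H.numPoints_eq hd hdp hn ((hG g).1 hg).1 ((hG g).1 hg).2 (E := E), Finset.sum_comm,
    Finset.mul_sum]
  refine Finset.sum_congr rfl fun x _ => ?_
  by_cases hx : evalAt E x h = 0
  · simp [fiberCount, hx]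
  by_cases hfree : IsTraceFree F p x
  · rw [if_pos ⟨hx, hfree⟩, Finset.sum_congr rfl fun g hg => fiberCount_of_isTraceFree
      ((hG g).1 hg).1 (H.isHomogeneous_of_eq hn) hx hfree, Finset.sum_const, smul_eq_mul]
  · rw [if_neg fun h' => hfree h'.2, mul_one]
    obtain ⟨τ, hτhom, hτ, htr⟩ := H.exists_translation hd hn hk hx hfree
    refine sum_fiberCount_of_translation hx G τ (fun g hg => ?_) htr
    rw [hG] at hg ⊢
    exact ⟨hg.1.add hτhom, H.isRelPrime_add hd hτ hg.2⟩

omit [Fact p.Prime] [CharP F p] [Finite F] in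
theorem sum_weight_of_not_dvd (hpk : ¬ p ∣ Module.finrank F E) :
    open Classical in (∑ x : Option E, if evalAt E x h ≠ 0 ∧ IsTraceFree F p x then p else 1) =
      Nat.card E + 1 := by
  classical
  rw [Finset.sum_congr rfl fun x _ => if_neg fun h' => hpk ?_]
  · simp
  · exact h'.2.trans ⟨Module.finrank F F⟮x.getD 0⟯, by
      rw [mul_comm, Module.finrank_mul_finrank F F⟮x.getD 0⟯ E]⟩

omit [CharP F p] in
/-- The zeros of `h` are subtracted factor by factor, as no two factors have a common zero. -/
theorem sum_weight_of_dvd (H : IsFactorization P r d h) (hd : ∀ i, d i ≠ 0)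
    (hpk : p ∣ Module.finrank F E) :
    open Classical in
    ((∑ x : Option E, if evalAt E x h ≠ 0 ∧ IsTraceFree F p x then p else 1 : ℕ) : ℚ) =
      Nat.card E + 1 + (p - 1) * (Nat.card F : ℚ) ^ (Module.finrank F E / p) +
        (p - 1) * (1 - ∑ i, if p * r i ∣ Module.finrank F E then (r i : ℚ) else 0) := by
  classical
  have h1 : ∀ x : Option E,
      ((if evalAt E x h ≠ 0 ∧ IsTraceFree F p x then p else 1 : ℕ) : ℚ) =
        1 + (p - 1) * ((if IsTraceFree F p x then 1 else 0) -
          ∑ i, if evalAt E x (P i) = 0 ∧ IsTraceFree F p x then 1 else 0) := by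
    intro x
    by_cases hfree : IsTraceFree F p x
    · by_cases hx : evalAt E x h = 0
      · obtain ⟨i, hi⟩ := (H.evalAt_eq_zero_iff hd).1 hx
        rw [Finset.sum_eq_single i (fun j _ hj => if_neg fun h' =>
          hj (H.eq_of_evalAt_eq_zero h'.1 hi)) (by simp)]
        simp [hx, hfree, hi]
      · rw [Finset.sum_eq_zero fun i _ => if_neg fun h' =>
          hx ((H.evalAt_eq_zero_iff hd).2 ⟨i, h'.1⟩)]
        simp [hx, hfree]
    · simp [hfree]
  have h2 : (∑ x : Option E, (if IsTraceFree F p x then 1 else 0 : ℚ)) =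
      (Nat.card F : ℚ) ^ (Module.finrank F E / p) + 1 := by
    have := congrArg (Nat.cast : ℕ → ℚ) (card_filter_isTraceFree (p := p) (F := F) (E := E) hpk)
    rw [Finset.card_filter] at this
    push_cast at this
    exact this
  have h3 : ∀ i, (∑ x : Option E,
      (if evalAt E x (P i) = 0 ∧ IsTraceFree F p x then 1 else 0 : ℚ)) =
        if p * r i ∣ Module.finrank F E then (r i : ℚ) else 0 := by
    intro i
    have := congrArg (Nat.cast : ℕ → ℚ) (card_filter_evalAt_eq_zero (p := p) (E := E)
      (H.isHomogeneous i) (H.irreducible i))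
    rw [Finset.card_filter] at this
    push_cast at this
    exact this
  rw [Nat.cast_sum, Finset.sum_congr rfl fun x _ => h1 x, Finset.sum_add_distrib,
    ← Finset.mul_sum, Finset.sum_sub_distrib, Finset.sum_comm, h2,
    Finset.sum_congr rfl fun i _ => h3 i]
  simp
  ring

end IsFactorization
end Sums

/-! ### Averages -/

section Averages

variable {F : Type*} [Field F]

theorem finite_setOf_isHomogeneous [Finite F] (n : ℕ) :
    {g : MvPolynomial (Fin 2) F | g.IsHomogeneous n}.Finite := by
  have hfin : Finite (degreeLT F (n + 1)) :=
    Finite.of_equiv _ (degreeLTEquiv F (n + 1)).toEquiv.symm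
  refine (Set.finite_range fun f : degreeLT F (n + 1) => (f : F[X]).homogenize n).subset ?_
  intro g hg
  refine ⟨⟨dehom F g, mem_degreeLT.2 ?_⟩, homogenize_dehom hg⟩
  exact lt_of_le_of_lt degree_le_natDegree
    (by exact_mod_cast Nat.lt_succ_of_le (natDegree_dehom_le hg))

theorem average_eq_div_card {α : Type*} (T : Finset α) (N : α → ℕ) :
    average (T : Set α) N = (∑ x ∈ T, N x : ℕ) / T.card := by
  rw [average, finsum_mem_coe_finset, Set.ncard_coe_finset]
  push_cast
  rfl

/-- An average over pairs all of whose partial averages over the first component agree. -/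
theorem average_eq_of_forall_snd {α : Type*} {S : Set (α × α)} (hS : S.Finite)
    (hne : S.Nonempty) (N : α × α → ℕ) (c : ℚ)
    (h : ∀ b ∈ Prod.snd '' S, ∀ G : Finset α, (∀ a, a ∈ G ↔ (a, b) ∈ S) →
      ((∑ a ∈ G, N (a, b) : ℕ) : ℚ) = G.card * c) : average S N = c := by
  classical
  obtain ⟨T, rfl⟩ := hS.exists_finset_coe
  have hT : (T.card : ℚ) ≠ 0 := by
    rw [Nat.cast_ne_zero, Finset.card_ne_zero]
    exact Finset.coe_nonempty.1 hne
  rw [average_eq_div_card, div_eq_iff hT, mul_comm]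
  rw [Finset.card_eq_sum_card_image Prod.snd T,
    ← Finset.sum_fiberwise_of_maps_to (fun x hx => Finset.mem_image_of_mem Prod.snd hx),
    Nat.cast_sum, Nat.cast_sum, Finset.sum_mul]
  refine Finset.sum_congr rfl fun b hb => ?_
  rw [Finset.mem_image] at hb
  set U := T.filter fun x => x.2 = b with hU
  have hinj : Set.InjOn Prod.fst (U : Set (α × α)) := by
    rintro ⟨a, b₁⟩ h₁ ⟨a', b₂⟩ h₂ rfl
    rw [Finset.mem_coe, Finset.mem_filter] at h₁ h₂
    exact Prod.ext rfl (h₁.2.trans h₂.2.symm)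
  have hG := h b hb (U.image Prod.fst) (fun a => by
    simp only [hU, Finset.mem_image, Finset.mem_filter, Finset.mem_coe]
    constructor
    · rintro ⟨⟨a', b'⟩, ⟨h1, rfl⟩, rfl⟩
      exact h1
    · exact fun h1 => ⟨(a, b), ⟨h1, rfl⟩, rfl⟩)
  rw [Finset.card_image_of_injOn hinj, Finset.sum_image hinj] at hG
  rw [← hG]
  congr 1
  refine Finset.sum_congr rfl fun x hx => ?_
  rw [Finset.mem_filter] at hx
  rw [← hx.2]

variable {p : ℕ} [Fact p.Prime] [CharP F p] [Finite F] {E : Type*} [Field E] [Algebra F E]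
  [Fintype E]

/-- The average over the numerators of a fixed denominator. -/
theorem IsFactorization.cast_sum_numPoints {ι : Type*} [Fintype ι] [Nonempty ι]
    {P : ι → MvPolynomial (Fin 2) F} {r d : ι → ℕ} {h : MvPolynomial (Fin 2) F} {n : ℕ}
    (H : IsFactorization P r d h) (hd : ∀ i, d i ≠ 0) (hdp : ∀ i, ¬ p ∣ d i)
    (hn : n = ∑ i, r i * d i) (G : Finset (MvPolynomial (Fin 2) F))
    (hG : ∀ g, g ∈ G ↔ g.IsHomogeneous n ∧ IsRelPrime g h) :
    (¬ p ∣ Module.finrank F E → ((∑ g ∈ G, numPoints p g h E : ℕ) : ℚ) =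
      G.card * ((Nat.card F : ℚ) ^ Module.finrank F E + 1)) ∧
    (p ∣ Module.finrank F E → Module.finrank F E + ∑ i, r i ≤ n + 1 →
      ((∑ g ∈ G, numPoints p g h E : ℕ) : ℚ) =
      G.card * ((Nat.card F : ℚ) ^ Module.finrank F E + 1 +
        (p - 1) * (Nat.card F : ℚ) ^ (Module.finrank F E / p) +
        (p - 1) * (1 - ∑ i, if p * r i ∣ Module.finrank F E then (r i : ℚ) else 0))) := by
  have hE : (Nat.card E : ℚ) = (Nat.card F : ℚ) ^ Module.finrank F E := by
    rw [Module.natCard_eq_pow_finrank (K := F) (V := E), Nat.cast_pow]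
  constructor
  · intro hpk
    rw [H.sum_numPoints_eq_card_mul hd hdp hn (fun h => absurd h hpk) G hG,
      sum_weight_of_not_dvd hpk, Nat.cast_mul, ← hE]
    push_cast
    rfl
  · intro hpk hk
    rw [H.sum_numPoints_eq_card_mul hd hdp hn (fun _ => hk) G hG, Nat.cast_mul,
      H.sum_weight_of_dvd hd hpk, hE]

omit [Fact p.Prime] [CharP F p] [Finite F] in
theorem isFactorization_X_one_pow (d : ℕ) :
    IsFactorization (fun _ : Unit => (MvPolynomial.X 1 : MvPolynomial (Fin 2) F)) (fun _ => 1)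
      (fun _ => d) (MvPolynomial.X 1 ^ d) where
  isHomogeneous _ := MvPolynomial.isHomogeneous_X F 1
  irreducible _ := irreducible_X_one
  eq_of_associated _ _ _ := rfl
  associated := by simp

omit [Finite F] in
/-- Polynomials of degree `d` are the dehomogenizations of the forms of degree `d` prime to the
second variable. -/
theorem coe_image_dehom_eq_rankZeroFamily {d : ℕ} (hd : d ≠ 0)
    (G : Finset (MvPolynomial (Fin 2) F))
    (hG : ∀ g, g ∈ G ↔ g.IsHomogeneous d ∧ IsRelPrime g (MvPolynomial.X 1 ^ d)) :
    open Classical in ((G.image (dehom F) : Finset F[X]) : Set F[X]) = rankZeroFamily F d := by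
  classical
  have hinf : ∀ g : MvPolynomial (Fin 2) F, g.IsHomogeneous d →
      (IsRelPrime g (MvPolynomial.X 1 ^ d) ↔ (dehom F g).coeff d ≠ 0) := by
    intro g hg
    have hev := aeval_infty (E := F) hg
    rw [(isFactorization_X_one_pow d).isRelPrime_iff (fun _ => hd)]
    refine ⟨fun hX h0 => hX () ?_, fun h0 _ hX => h0 ?_⟩
    · exact X_one_dvd_of_aeval_infty (E := F) hg (by rw [hev, h0, map_zero])
    · obtain ⟨g', rfl⟩ := hX
      rw [map_mul] at hev
      simpa using hev.symm
  ext f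
  rw [Finset.mem_coe, Finset.mem_image, rankZeroFamily, Set.mem_ofPred_eq]
  constructor
  · rintro ⟨g, hg, rfl⟩
    rw [hG] at hg
    have h0 := (hinf g hg.1).1 hg.2
    refine le_antisymm (degree_le_of_natDegree_le (natDegree_dehom_le hg.1)) ?_
    exact le_degree_of_ne_zero h0
  · intro hf
    have hnat : f.natDegree = d := natDegree_eq_of_degree_eq_some hf
    have hdeh : dehom F (f.homogenize d) = f := dehom_homogenize hnat.le
    refine ⟨f.homogenize d, (hG _).2 ⟨isHomogeneous_homogenize f,
      (hinf _ (isHomogeneous_homogenize f)).2 ?_⟩, hdeh⟩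
    rw [hdeh]
    exact coeff_ne_zero_of_eq_degree hf

omit [Fact p.Prime] [CharP F p] [Fintype E] in
theorem average_rankZeroFamily {d : ℕ} (hd : d ≠ 0) {c : ℚ}
    (h : ∀ G : Finset (MvPolynomial (Fin 2) F),
      (∀ g, g ∈ G ↔ g.IsHomogeneous d ∧ IsRelPrime g (MvPolynomial.X 1 ^ d)) →
      ((∑ g ∈ G, numPoints p g (MvPolynomial.X 1 ^ d) E : ℕ) : ℚ) = G.card * c) :
    average (rankZeroFamily F d) (fun f => numPointsPolynomial p f E) = c := by
  classical
  have hfin : {g : MvPolynomial (Fin 2) F | g.IsHomogeneous d ∧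
      IsRelPrime g (MvPolynomial.X 1 ^ d)}.Finite :=
    (finite_setOf_isHomogeneous d).subset fun g hg => hg.1
  have hG : ∀ g, g ∈ hfin.toFinset ↔ g.IsHomogeneous d ∧ IsRelPrime g (MvPolynomial.X 1 ^ d) :=
    fun g => hfin.mem_toFinset
  have hS := coe_image_dehom_eq_rankZeroFamily hd hfin.toFinset hG
  have hinj : Set.InjOn (dehom F) (hfin.toFinset : Set (MvPolynomial (Fin 2) F)) := by
    intro g hg g' hg' heq
    rw [Finset.mem_coe, hG] at hg hg'
    rw [← homogenize_dehom hg.1, heq, homogenize_dehom hg'.1]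
  have hne : (hfin.toFinset.card : ℚ) ≠ 0 := by
    rw [Nat.cast_ne_zero, Finset.card_ne_zero, ← Finset.image_nonempty (f := dehom F),
      ← Finset.coe_nonempty, hS]
    exact ⟨X ^ d, degree_X_pow d⟩
  have hsum : ∀ g ∈ hfin.toFinset, numPointsPolynomial p (dehom F g) E =
      numPoints p g (MvPolynomial.X 1 ^ d) E := by
    intro g hg
    have hmem : dehom F g ∈ rankZeroFamily F d := by
      rw [← hS]
      exact Finset.mem_coe.2 (Finset.mem_image_of_mem _ hg)
    have hnat : (dehom F g).natDegree = d := natDegree_eq_of_degree_eq_some hmem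
    rw [numPointsPolynomial, hnat, homogenize_dehom ((hG g).1 hg).1, homogenize_one]
  rw [← hS, average_eq_div_card, Finset.card_image_of_injOn hinj, div_eq_iff hne, mul_comm,
    Finset.sum_image hinj, Finset.sum_congr rfl hsum]
  exact h _ hG

namespace FactorizationType

variable (v : FactorizationType)

omit [Fact p.Prime] [CharP F p] [Finite F] in
theorem HasType.exists_isFactorization {v : FactorizationType} {h : MvPolynomial (Fin 2) F}
    (hv : v.HasType h) : ∃ P : ((i : Fin v.m) × Fin (v.ℓ i)) → MvPolynomial (Fin 2) F,
      IsFactorization P (fun x => v.r x.1) (fun x => v.d x.1 x.2) h := by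
  obtain ⟨P, hP, hassoc, hh⟩ := hv
  refine ⟨fun x => P x.1 x.2, fun x => (hP x.1 x.2).1, fun x => (hP x.1 x.2).2,
    fun x y hxy => hassoc x.1 x.2 y.1 y.2 hxy, ?_⟩
  rw [Fintype.prod_sigma]
  exact hh

theorem degree_eq_sum_sigma :
    v.degree = ∑ x : (i : Fin v.m) × Fin (v.ℓ i), v.r x.1 * v.d x.1 x.2 := by
  rw [degree, Fintype.sum_sigma]
  simp_rw [Finset.mul_sum]

theorem numPoles_eq_sum_sigma :
    v.numPoles = ∑ x : (i : Fin v.m) × Fin (v.ℓ i), v.r x.1 := by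
  rw [numPoles, Fintype.sum_sigma]
  simp

theorem sum_sigma_ite (Q : Fin v.m → Prop) [DecidablePred Q] :
    (∑ x : (i : Fin v.m) × Fin (v.ℓ i), if Q x.1 then (v.r x.1 : ℚ) else 0) =
      ∑ i with Q i, (v.ℓ i : ℚ) * v.r i := by
  rw [Fintype.sum_sigma, Finset.sum_filter]
  refine Finset.sum_congr rfl fun i _ => ?_
  simp

instance : Nonempty ((i : Fin v.m) × Fin (v.ℓ i)) :=
  ⟨⟨⟨0, v.m_pos⟩, ⟨0, v.ℓ_pos _⟩⟩⟩

end FactorizationType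

theorem average_family {v : FactorizationType} (hvp : ∀ i j, ¬ p ∣ v.d i j)
    (hne : (family F v).Nonempty) :
    (¬ p ∣ Module.finrank F E → average (family F v) (fun x => numPoints p x.1 x.2 E) =
      (Nat.card F : ℚ) ^ Module.finrank F E + 1) ∧
    (p ∣ Module.finrank F E → Module.finrank F E + v.numPoles ≤ v.degree + 1 →
      average (family F v) (fun x => numPoints p x.1 x.2 E) =
      (Nat.card F : ℚ) ^ Module.finrank F E + 1 +
        (p - 1) * (Nat.card F : ℚ) ^ (Module.finrank F E / p) +
        (p - 1) * (1 - ∑ i with p * v.r i ∣ Module.finrank F E, (v.ℓ i : ℚ) * v.r i)) := by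
  have hfin : (family F v).Finite :=
    ((finite_setOf_isHomogeneous v.degree).prod (finite_setOf_isHomogeneous v.degree)).subset
      fun x hx => ⟨hx.1, hx.2.1⟩
  have key : ∀ h ∈ Prod.snd '' family F v,
      (∃ P : ((i : Fin v.m) × Fin (v.ℓ i)) → MvPolynomial (Fin 2) F,
        IsFactorization P (fun x => v.r x.1) (fun x => v.d x.1 x.2) h) ∧
      ∀ g, (g, h) ∈ family F v ↔ g.IsHomogeneous v.degree ∧ IsRelPrime g h := by
    rintro _ ⟨⟨g₀, h⟩, hgh, rfl⟩
    exact ⟨hgh.2.2.2.exists_isFactorization, fun g =>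
      ⟨fun h => ⟨h.1, h.2.2.1⟩, fun h => ⟨h.1, hgh.2.1, h.2, hgh.2.2.2⟩⟩⟩
  refine ⟨fun hpk => average_eq_of_forall_snd hfin hne _ _ fun h hh G hG => ?_,
    fun hpk hk => ?_⟩
  · obtain ⟨⟨P, H⟩, hmem⟩ := key h hh
    exact (H.cast_sum_numPoints (fun x => (v.d_pos x.1 x.2).ne') (fun x => hvp x.1 x.2)
      v.degree_eq_sum_sigma G fun g => (hG g).trans (hmem g)).1 hpk
  · rw [← v.sum_sigma_ite]
    refine average_eq_of_forall_snd hfin hne _ _ fun h hh G hG => ?_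
    obtain ⟨⟨P, H⟩, hmem⟩ := key h hh
    exact (H.cast_sum_numPoints (fun x => (v.d_pos x.1 x.2).ne') (fun x => hvp x.1 x.2)
      v.degree_eq_sum_sigma G fun g => (hG g).trans (hmem g)).2 hpk
        (v.numPoles_eq_sum_sigma ▸ hk)

end Averages

end ArtinSchreier

end

theorem theorem4p3 (p : ℕ) (hp : p.Prime) (hodd : Odd p)
    (F : Type*) [Field F] [Finite F] [CharP F p]
    (k : ℕ) (hk : 0 < k)
    (E : Type*) [Field E] [Algebra F E] (hE : Module.finrank F E = k) :
    (∀ v : ArtinSchreier.FactorizationType, (∀ i j, ¬ p ∣ v.d i j) →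
      (ArtinSchreier.family F v).Nonempty →
      (¬ p ∣ k →
        ArtinSchreier.average (ArtinSchreier.family F v)
            (fun x => ArtinSchreier.numPoints p x.1 x.2 E) =
          (Nat.card F : ℚ) ^ k + 1) ∧
      (p ∣ k → k + v.numPoles ≤ v.degree + 1 →
        ArtinSchreier.average (ArtinSchreier.family F v)
            (fun x => ArtinSchreier.numPoints p x.1 x.2 E) =
          (Nat.card F : ℚ) ^ k + 1 + (p - 1) * (Nat.card F : ℚ) ^ (k / p) +
            (p - 1) * (1 - ∑ i with p * v.r i ∣ k, (v.ℓ i : ℚ) * v.r i)) ∧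
      (p ∣ k → k + v.numPoles ≤ v.degree + 1 → (∀ i, ¬ p ∣ v.r i) →
        ArtinSchreier.average (ArtinSchreier.family F v)
            (fun x => ArtinSchreier.numPoints p x.1 x.2 E) =
          (Nat.card F : ℚ) ^ k + 1 + (p - 1) * (Nat.card F : ℚ) ^ (k / p) +
            (p - 1) * (1 - ∑ i with v.r i ∣ k, (v.ℓ i : ℚ) * v.r i))) ∧
    (∀ d : ℕ, ¬ p ∣ d →
      (¬ p ∣ k →
        ArtinSchreier.average (ArtinSchreier.rankZeroFamily F d)
            (fun f => ArtinSchreier.numPointsPolynomial p f E) =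
          (Nat.card F : ℚ) ^ k + 1) ∧
      (p ∣ k → k ≤ d →
        ArtinSchreier.average (ArtinSchreier.rankZeroFamily F d)
            (fun f => ArtinSchreier.numPointsPolynomial p f E) =
          (Nat.card F : ℚ) ^ k + 1 + (p - 1) * (Nat.card F : ℚ) ^ (k / p))) := by
  have : Fact p.Prime := ⟨hp⟩
  subst hE
  have : Module.Finite F E := Module.finite_of_finrank_pos hk
  have : Finite E := Module.finite_of_finite F
  have := Fintype.ofFinite E
  refine ⟨fun v hvp hne => ?_, fun d hd => ?_⟩
  · obtain ⟨h1, h2⟩ := ArtinSchreier.average_family (E := E) hvp hne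
    refine ⟨h1, h2, fun hpk hdeg hr => ?_⟩
    rw [h2 hpk hdeg]
    have hiff : ∀ i, p * v.r i ∣ Module.finrank F E ↔ v.r i ∣ Module.finrank F E := fun i =>
      ⟨fun h => (dvd_mul_left _ _).trans h, fun h =>
        ((hp.coprime_iff_not_dvd.2 (hr i)).mul_dvd_of_dvd_of_dvd hpk h)⟩
    simp_rw [hiff]
  · have hd0 : d ≠ 0 := by rintro rfl; exact hd (dvd_zero p)
    have key := fun (G : Finset (MvPolynomial (Fin 2) F)) hG =>
      (ArtinSchreier.isFactorization_X_one_pow (F := F) d).cast_sum_numPoints (p := p) (E := E)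
        (n := d) (fun _ => hd0) (fun _ => hd) (by simp) G hG
    refine ⟨fun hpk => ?_, fun hpk hkd => ?_⟩
    · exact ArtinSchreier.average_rankZeroFamily hd0 fun G hG => (key G hG).1 hpk
    · refine ArtinSchreier.average_rankZeroFamily hd0 fun G hG => ?_
      rw [(key G hG).2 hpk (by simpa using hkd)]
      simp [hpk]
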